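/- Let $P$ be the transition matrix of an ergodic (irreducible, aperiodic) Markov chain on $\{0,1,\dots,n\}$ that is reversible with respect to its stationary distribution $\pi$. Write $A_0$ for a matrix $A$ with row $0$ and column $0$ deleted, and $A_{\rm abs}$ for $A$ with row $0$ replaced by $\delta_0$. All vectors are row vectors, $\vec 1=(1,\dots,1)$. Let $\sigma(P)$, $\sigma(P_0)$ be the multisets of eigenvalues (all real). Remove the multiset $\sigma(P)\cap\sigma(P_0)$ from each. Let $r$ be the number of elements left of $\sigma(P_0)$, written $\gamma_1\ge\dots\ge\gamma_r$. Then $r+1$ elements are left of $\sigma(P)$; written $\lambda_0\ge\dots\ge\lambda_r$, they strictly interlace with the $\gamma_i$: $$1=\lambda_0>\gamma_1>\lambda_1>\dots>\gamma_r>\lambda_r .$$ Assume $\lambda_r\ge 0$ and put $\rho_i=\frac{1-\gamma_i}{1-\lambda_i}$ for $1\le i\le r$. On $\{0,\dots,r\}$ define, for $0\le k\le r$, vectors $\pi^*_k$ and $\hat\pi_k$, both vanishing at $i>k$, by $\pi^*_k(0)=\hat\pi_k(0)=\prod_{j=1}^k\rho_j$ and, for $1\le i\le k$, $$\pi^*_k(i)=(1-\rho_i)\prod_{1\le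 j\le k,\,j\ne i}\frac{1-\gamma_j-\rho_j(1-\gamma_i)}{\gamma_i-\gamma_j},\qquad \hat\pi_k(i)=(1-\rho_i)\prod_{j=i+1}^k\rho_j .$$ Put $\pi^*=\pi^*_r$ and $\hat\pi=\hat\pi_r$. Let $P^*$ be the star-chain matrix with, for $i\ge1$, $P^*(i,0)=1-\gamma_i$, $P^*(i,i)=\gamma_i$, $P^*(0,i)=(1-\gamma_i)\pi^*(i)/\pi^*(0)$, $P^*(0,0)=1-\sum_{i\ge1}P^*(0,i)$ and all other entries $0$. Let $\hat P$ be the matrix with $\hat P(0,0)=1$, $\hat P(i,i)=\gamma_i$ for $i\ge1$, $\hat P(i,j)=(1-\gamma_i)\hat\pi_{i-1}(j)$ for $j<i$, and $\hat P(i,j)=0$ for $j>i$. Let $\Lambda_2$ be the $(r+1)\times(r+1)$ matrix with row $0$ equal to $\delta_0$ and, for $i\ge1$, row $i$ equal to the vector $\nu_i$ determined by $\pi^*_i=\rho_i\pi^*_{i-1}+(1-\rho_i)\nu_i$. Let $D_0={\rm diag}(\pi(1),\dots,\pi(n))$, and let $\tilde U$ be an orthogonal $n\times n$ matrix with $\tilde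 U D_0^{1/2}P_0D_0^{-1/2}\tilde U^T={\rm diag}(\eta_1,\dots,\eta_n)$ (such $\tilde U$ exist). The rows $u_1,\dots,u_n$ of $\tilde UD_0^{1/2}$ form a basis of left eigenvectors of $P_0$; write $(\pi(1),\dots,\pi(n))=\sum_k a_ku_k$. Let $\Lambda_1$ be the $(r+1)\times(n+1)$ matrix with row $0$ equal to $\delta_0$ and row $i\ge1$ equal to $$\delta_0+\sum_{k:\,\eta_k=\gamma_i}\frac{a_k}{\pi^*(i)}\,(-u_k\vec1^{\,T}\mid u_k).$$ A matrix $\Lambda$ with rows summing to $1$ (entries of any sign) is called a quasi-link giving a quasi-intertwining of $(\mu,Q)$ and $(\mu',Q')$ if $\Lambda Q=Q'\Lambda$ and $\mu=\mu'\Lambda$; it is a link if it is also nonnegative. Then the following hold. 1. $\hat\pi$ is a probability distribution and $\hat P$ is a stochastic matrix; $\Lambda_2$ is a link giving a quasi-intertwining of $(\pi^*,P^*_{\rm abs})$ and $(\hat\pi,\hat P)$; for every choice of $\tilde U$, $\Lambda_1$ is a quasi-link giving a quasi-intertwining of $(\pi,P_{\rm abs})$ and $(\pi^*,P^*_{\rm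 abs})$; and for both matrices column $0$ is $\delta_0^T$. 2. For every choice of $\tilde U$, $\Lambda=\Lambda_2\Lambda_1$ is a quasi-link giving a quasi-intertwining of $(\pi,P_{\rm abs})$ and $(\hat\pi,\hat P)$, and $\Lambda\delta_0^T=\delta_0^T$. 3. The hitting time $T_0=\min\{t\ge0:X_t=0\}$ of the chain $X$ with initial distribution $\pi$ and transition matrix $P$ has the same law as the hitting time of $0$ of the chain with initial distribution $\hat\pi$ and transition matrix $\hat P$. 4. $T_0$ has the law of $\sum_{i=1}^rY_i$ with $Y_1,\dots,Y_r$ independent and $$Y_i\sim\rho_i\,\delta_0+(1-\rho_i)\,{\rm Geo}(1-\gamma_i),$$ where ${\rm Geo}(p)$ gives mass $(1-p)^{k-1}p$ to $k=1,2,\dots$. -/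

import Mathlib

open MeasureTheory ProbabilityTheory
open scoped ENNReal

noncomputable section

namespace InterlacedHitting

/-! ### Chains and reduced spectra -/

/-- `P` is the transition matrix of an ergodic (irreducible and aperiodic, i.e. primitive) chain on
`{0, …, n}` that is time-reversible with respect to its stationary distribution `π`. -/
structure IsReversibleErgodic {n : ℕ} (P : Matrix (Fin (n + 1)) (Fin (n + 1)) ℝ)
    (π : Fin (n + 1) → ℝ) : Prop where
  stochastic : P ∈ Matrix.rowStochastic ℝ (Fin (n + 1))
  ergodic : P.IsPrimitive
  distribution : π ∈ stdSimplex ℝ (Fin (n + 1))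
  stationary : Matrix.vecMul π P = π
  reversible : ∀ i j, π i * P i j = π j * P j i

/-- The principal submatrix obtained by deleting row `0` and column `0`. -/
def deleteZero {n : ℕ} (P : Matrix (Fin (n + 1)) (Fin (n + 1)) ℝ) : Matrix (Fin n) (Fin n) ℝ :=
  P.submatrix Fin.succ Fin.succ

/-- The transition matrix with state `0` turned into an absorbing state. -/
def absorb {n : ℕ} (P : Matrix (Fin (n + 1)) (Fin (n + 1)) ℝ) :
    Matrix (Fin (n + 1)) (Fin (n + 1)) ℝ :=
  P.updateRow 0 (Pi.single 0 1)

/-- The multiset of real eigenvalues, with algebraic multiplicity. -/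
def spec {m : ℕ} (A : Matrix (Fin m) (Fin m) ℝ) : Multiset ℝ := A.charpoly.roots

/-- The spectrum of `P` after cancellation of the common part with the spectrum of the principal
submatrix. -/
def reducedSpec {n : ℕ} (P : Matrix (Fin (n + 1)) (Fin (n + 1)) ℝ) : Multiset ℝ :=
  spec P - spec P ∩ spec (deleteZero P)

/-- The spectrum of the principal submatrix after the same cancellation. -/
def reducedSpecZero {n : ℕ} (P : Matrix (Fin (n + 1)) (Fin (n + 1)) ℝ) : Multiset ℝ :=
  spec (deleteZero P) - spec P ∩ spec (deleteZero P)

/-- The number `r` of eigenvalues left in the spectrum of the principal submatrix. -/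
def reducedCard {n : ℕ} (P : Matrix (Fin (n + 1)) (Fin (n + 1)) ℝ) : ℕ :=
  (reducedSpecZero P).card

/-- `λ₀ ≥ λ₁ ≥ ⋯ ≥ λ_r`: the reduced eigenvalues of `P` in decreasing order
(values at indices past the end are irrelevant). -/
def reducedLam {n : ℕ} (P : Matrix (Fin (n + 1)) (Fin (n + 1)) ℝ) (i : ℕ) : ℝ :=
  ((reducedSpec P).sort (· ≥ ·)).getD i 0

/-- `γ₁ ≥ ⋯ ≥ γ_r`: the reduced eigenvalues of the principal submatrix in decreasing order, numbered
from `1` (values at index `0` and at indices past the end are irrelevant). -/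
def reducedGam {n : ℕ} (P : Matrix (Fin (n + 1)) (Fin (n + 1)) ℝ) (i : ℕ) : ℝ :=
  ((reducedSpecZero P).sort (· ≥ ·)).getD (i - 1) 0

/-! ### Quasi-intertwinings -/

/-- `Λ` (rows summing to one, entries of any sign) is a quasi-link providing a quasi-intertwining of
`(π, P)` and `(π', P')`. -/
structure IsQuasiIntertwining {m n : ℕ} (Λ : Matrix (Fin m) (Fin n) ℝ)
    (π : Fin n → ℝ) (P : Matrix (Fin n) (Fin n) ℝ)
    (π' : Fin m → ℝ) (P' : Matrix (Fin m) (Fin m) ℝ) : Prop where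
  row_sum : ∀ i, ∑ j, Λ i j = 1
  intertwine : Λ * P = P' * Λ
  initial : π = Matrix.vecMul π' Λ

/-- The column of `Λ` at state `0` is the indicator of the dual state `0`. -/
def MatchesZero {m n : ℕ} (Λ : Matrix (Fin (m + 1)) (Fin (n + 1)) ℝ) : Prop :=
  ∀ i, Λ i 0 = if i = 0 then 1 else 0

/-! ### The star chain and the downward chain

Both live on `{0, …, r}` and depend on sequences `ρ` and `γ`, used at the indices `1, …, r`. -/

/-- The distribution `π*_k` on `{0, …, r}`, for `0 ≤ k ≤ r`. -/
def starDist (r : ℕ) (ρ γ : ℕ → ℝ) (k : ℕ) : Fin (r + 1) → ℝ := fun i =>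
  if (i : ℕ) = 0 then ∏ j ∈ Finset.Icc 1 k, ρ j
  else if (i : ℕ) ≤ k then
    (1 - ρ i) * ∏ j ∈ (Finset.Icc 1 k).erase (i : ℕ), (1 - γ j - ρ j * (1 - γ i)) / (γ i - γ j)
  else 0

/-- The transition matrix `P*` of the star chain, with hub `0`. -/
def starMatrix (r : ℕ) (ρ γ : ℕ → ℝ) : Matrix (Fin (r + 1)) (Fin (r + 1)) ℝ := fun i j =>
  if i = 0 then
    if j = 0 then
      1 - (1 / starDist r ρ γ r 0) *
        ∑ l ∈ Finset.univ.erase (0 : Fin (r + 1)), (1 - γ l) * starDist r ρ γ r l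
    else (1 - γ j) * starDist r ρ γ r j / starDist r ρ γ r 0
  else if j = 0 then 1 - γ i
  else if j = i then γ i
  else 0

/-- The vector `ν_i`, i.e. the unique solution of `π*_i = ρ_i π*_{i-1} + (1 - ρ_i) ν_i`. -/
def nu (r : ℕ) (ρ γ : ℕ → ℝ) (i : ℕ) : Fin (r + 1) → ℝ := fun j =>
  (starDist r ρ γ i j - ρ i * starDist r ρ γ (i - 1) j) / (1 - ρ i)

/-- The matrix `Λ₂`: row `0` is the point mass at `0`, row `i ≥ 1` is `ν_i`. -/
def linkTwo (r : ℕ) (ρ γ : ℕ → ℝ) : Matrix (Fin (r + 1)) (Fin (r + 1)) ℝ := fun i =>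
  if i = 0 then Pi.single 0 1 else nu r ρ γ i

/-- The distribution `π̂_k` on `{0, …, r}`, for `0 ≤ k ≤ r`. -/
def hatDist (r : ℕ) (ρ : ℕ → ℝ) (k : ℕ) : Fin (r + 1) → ℝ := fun j =>
  if (j : ℕ) = 0 then ∏ l ∈ Finset.Icc 1 k, ρ l
  else if (j : ℕ) ≤ k then (1 - ρ j) * ∏ l ∈ Finset.Icc ((j : ℕ) + 1) k, ρ l
  else 0

/-- The transition matrix `P̂` of the downward chain. -/
def hatMatrix (r : ℕ) (ρ γ : ℕ → ℝ) : Matrix (Fin (r + 1)) (Fin (r + 1)) ℝ := fun i j =>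
  if i < j then 0
  else if j = i then (if i = 0 then 1 else γ i)
  else (1 - γ i) * hatDist r ρ ((i : ℕ) - 1) j

/-! ### The quasi-link `Λ₁` to the star chain -/

/-- The rows of the orthogonal matrix `U` are orthonormal left eigenvectors, with eigenvalues `η`, of
the symmetric matrix `S₀ = D₀^{1/2} P₀ D₀^{-1/2}`, where `D₀ = diag (π 1, …, π n)` and `P₀` is the
principal submatrix of `P`. -/
structure IsEigenframe {n : ℕ} (P : Matrix (Fin (n + 1)) (Fin (n + 1)) ℝ) (π : Fin (n + 1) → ℝ)
    (U : Matrix (Fin n) (Fin n) ℝ) (η : Fin n → ℝ) : Prop where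
  orthogonal : U * U.transpose = 1
  eigen : U * (Matrix.diagonal (fun m : Fin n => √(π m.succ)) * deleteZero P *
      Matrix.diagonal (fun m : Fin n => (√(π m.succ))⁻¹)) * U.transpose = Matrix.diagonal η

/-- Row `k` of `U D₀^{1/2}`, a left eigenvector `u_k` of the principal submatrix of `P`. -/
def eigRow {n : ℕ} (π : Fin (n + 1) → ℝ) (U : Matrix (Fin n) (Fin n) ℝ) (k : Fin n) : Fin n → ℝ :=
  fun m => U k m * √(π m.succ)

/-- The coordinate of `(π 1, …, π n)` along the eigenvector `u_k`. -/
def eigCoord {n : ℕ} (π : Fin (n + 1) → ℝ) (U : Matrix (Fin n) (Fin n) ℝ) (k : Fin n) : ℝ :=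
  ∑ m : Fin n, √(π m.succ) * U k m

/-- The matrix `Λ₁`: row `0` is the point mass `δ₀`, and row `i ≥ 1` is
`δ₀ + ∑_{k : η_k = γ_i} c_k (- u_k 1ᵀ | u_k)`, where `π*(i) c_k` is the coordinate of `(π 1, …, π n)`
along `u_k`. -/
def linkOne {n : ℕ} (r : ℕ) (ρ γ : ℕ → ℝ) (π : Fin (n + 1) → ℝ)
    (U : Matrix (Fin n) (Fin n) ℝ) (η : Fin n → ℝ) : Matrix (Fin (r + 1)) (Fin (n + 1)) ℝ := fun i =>
  if i = 0 then Pi.single 0 1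
  else Pi.single 0 1 + ∑ k ∈ Finset.univ.filter (fun k : Fin n => η k = γ i),
    (eigCoord π U k / starDist r ρ γ r i) •
      (Fin.cons (-∑ m, eigRow π U k m) (eigRow π U k) : Fin (n + 1) → ℝ)

/-! ### Hitting times -/

/-- Under the probability measure `μ`, `X` is a Markov chain on `{0, …, n}` with initial
distribution `π` and transition matrix `P`. -/
structure IsMarkovChain {Ω : Type*} [MeasurableSpace Ω] (μ : Measure Ω) {n : ℕ}
    (X : ℕ → Ω → Fin (n + 1)) (π : Fin (n + 1) → ℝ) (P : Matrix (Fin (n + 1)) (Fin (n + 1)) ℝ) :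
    Prop where
  isProbabilityMeasure : IsProbabilityMeasure μ
  measurable : ∀ t, Measurable (X t)
  law : ∀ (t : ℕ) (x : ℕ → Fin (n + 1)), μ {ω | ∀ s ≤ t, X s ω = x s} =
    ENNReal.ofReal (π (x 0) * ∏ s ∈ Finset.range t, P (x s) (x (s + 1)))

/-- The first time `t ≥ 0` with `X t = 0`, and `⊤` if there is none. -/
def hitZero {Ω : Type*} {n : ℕ} (X : ℕ → Ω → Fin (n + 1)) : Ω → ℕ∞ :=
  MeasureTheory.hittingAfter X {0} 0

/-- The geometric distribution on `{1, 2, …}` with success probability `p ∈ [0, 1]`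
(Mathlib's counts failures and lives on `{0, 1, …}`). -/
def geo (p : ℝ) : Measure ℕ :=
  (geometricMeasure (Set.projIcc 0 1 zero_le_one p)).map (· + 1)

/-- The modified geometric distribution `ρ δ₀ + (1 - ρ) Geo(p)`. -/
def modifiedGeo (ρ p : ℝ) : Measure ℕ :=
  ENNReal.ofReal ρ • Measure.dirac 0 + ENNReal.ofReal (1 - ρ) • geo p

end InterlacedHitting

end

noncomputable section

namespace InterlacedHitting

/-! ### Row sums and intertwining for the star chain and the downward chain -/

/-! The law of `T₀` depends only on the pair `(π, P_abs)`, since `P(T₀ ≤ t) = (π P_abs^t)(0)`. If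
`Λ` quasi-intertwines two such pairs and `Λ δ₀ᵀ = δ₀ᵀ`, then `π P^t δ₀ᵀ = π' Λ P^t δ₀ᵀ = π' P'^t Λ
δ₀ᵀ = π' P'^t δ₀ᵀ`, whatever the signs of `Λ`. So it suffices to pass from `P_abs` to the absorbed
star chain by `Λ₁`, and from there to `P̂` by `Λ₂`.

`Λ₂`: the absorbed star matrix multiplies coordinate `j ≠ 0` by `γ_j`, so its intertwining is an
identity for each coordinate (`nu_mul_sub`). Moreover `π*_k` and `π̂_k` obey the same mixture
recursion, with `ν_k` in one and `δ_k` in the other, whence `π̂_k Λ₂ = π*_k`.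

`Λ₁`: its rows are built from the components of `(π(1), …, π(n))` in the eigenspaces of `P₀`, so
intertwining is immediate. What must be proved is `π*(i) = ∑_{η_k = γ_i} a_k²`, and that no other
eigenspace contributes. Cramer's rule gives `π(0) χ_P(z) = χ_{P₀}(z) (z - 1) (1 - (z - 1) ∑ a_k² /
(z - η_k))` (`eval_charpoly_mul`). With denominators cleared, the last factor becomes a polynomial
`G` of degree equal to the number of eigenvalues of `P₀` with nonzero weight. `G` alternates in sign
along these eigenvalues, so its roots interlace with them and nothing further cancels: these are the
reduced spectra (`reducedSpec_interlaced`). The values of `G` at `1` and at `γ_i` yield `π(0) = ∏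
ρ_j` and the product formula for `π*(i)` (`starDist_eq`).

Finally, from state `k` the downward chain waits a geometric time and restarts from `π̂_{k-1}`.
Together with the recursion for `π̂_k`, this makes the law of its hitting time a convolution of
modified geometric laws (`measure_sum_modifiedGeo_le`). -/

lemma sum_fin_ite_le {r k : ℕ} (hk : k ≤ r) (a : ℝ) (g : ℕ → ℝ) :
    ∑ i : Fin (r + 1), (if (i : ℕ) = 0 then a else if (i : ℕ) ≤ k then g i else 0) =
      a + ∑ i ∈ Finset.Icc 1 k, g i := by
  rw [Fin.sum_univ_succ]
  simp only [Fin.val_zero, if_true, Fin.val_succ, Nat.add_eq_zero_iff, one_ne_zero, and_false,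
    if_false]
  congr 1
  rw [Fin.sum_univ_eq_sum_range (fun i => if i + 1 ≤ k then g (i + 1) else 0) r,
    ← Finset.sum_filter]
  refine Finset.sum_bij (fun i _ => i + 1) ?_ ?_ ?_ ?_
  · intro i hi
    simp only [Finset.mem_filter, Finset.mem_range, Finset.mem_Icc] at hi ⊢
    omega
  · intro i _ j _ h
    omega
  · intro j hj
    simp only [Finset.mem_Icc] at hj
    exact ⟨j - 1, by simp only [Finset.mem_filter, Finset.mem_range]; omega, by omega⟩
  · intro i _
    rfl

lemma starDist_zero (r : ℕ) (ρ γ : ℕ → ℝ) (k : ℕ) :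
    starDist r ρ γ k 0 = ∏ j ∈ Finset.Icc 1 k, ρ j := by
  simp [starDist]

lemma starDist_of_lt {r : ℕ} (ρ γ : ℕ → ℝ) {k : ℕ} {i : Fin (r + 1)} (h : k < (i : ℕ)) :
    starDist r ρ γ k i = 0 := by
  rw [starDist, if_neg (by omega), if_neg (by omega)]

open Polynomial in
-- Lagrange interpolation of `Q(x) = ∏ (1 - γ_j - ρ_j (1 - x))`, of degree at most `k`, at the `k +
-- 1` nodes `1, γ_1, …, γ_k`. Its coefficient at `x^k` is `∏ ρ_j`; the node `1` contributes `1` to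
-- it and the node `γ_i` contributes `-π*_k(i)`.
lemma sum_starDist {r : ℕ} {ρ γ : ℕ → ℝ}
    (hinj : ∀ i j, 1 ≤ i → i < j → j ≤ r → γ j < γ i) (hlt : ∀ i, 1 ≤ i → i ≤ r → γ i < 1)
    {k : ℕ} (hk : k ≤ r) : ∑ i, starDist r ρ γ k i = 1 := by
  classical
  unfold starDist
  rw [sum_fin_ite_le hk _ (fun i => (1 - ρ i) * ∏ j ∈ (Finset.Icc 1 k).erase i,
    (1 - γ j - ρ j * (1 - γ i)) / (γ i - γ j))]
  set v : ℕ → ℝ := fun i => if i = 0 then 1 else γ i with hv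
  set Q : ℝ[X] := ∏ j ∈ Finset.Icc 1 k, (C (ρ j) * X + C (1 - γ j - ρ j)) with hQ
  have h0 : (0 : ℕ) ∉ Finset.Icc 1 k := by simp
  have hcard : (insert 0 (Finset.Icc 1 k)).card = k + 1 := by simp
  have hvs : Set.InjOn v (insert 0 (Finset.Icc 1 k) : Finset ℕ) := by
    intro i hi j hj hij
    simp only [Finset.coe_insert, Finset.coe_Icc, Set.mem_insert_iff, Set.mem_Icc] at hi hj
    rcases hi with rfl | hi <;> rcases hj with rfl | hj
    · rfl
    · simp only [hv, if_true, if_neg (show j ≠ 0 by omega)] at hij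
      linarith [hlt j hj.1 (by omega)]
    · simp only [hv, if_true, if_neg (show i ≠ 0 by omega)] at hij
      linarith [hlt i hi.1 (by omega)]
    · simp only [hv, if_neg (show j ≠ 0 by omega), if_neg (show i ≠ 0 by omega)] at hij
      rcases lt_trichotomy i j with h | h | h
      · linarith [hinj i j hi.1 h (by omega)]
      · exact h
      · linarith [hinj j i hj.1 h (by omega)]
  have hdeg : ∀ j ∈ Finset.Icc 1 k, (C (ρ j) * X + C (1 - γ j - ρ j) : ℝ[X]).natDegree ≤ 1 :=
    fun j _ => natDegree_linear_le
  have hQdeg : Q.degree < (insert 0 (Finset.Icc 1 k)).card := by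
    rw [hcard]
    refine lt_of_le_of_lt degree_le_natDegree ?_
    have : Q.natDegree ≤ k := (natDegree_prod_le _ _).trans
      ((Finset.sum_le_card_nsmul _ _ 1 hdeg).trans (by simp))
    exact_mod_cast Nat.lt_succ_of_le this
  have hcoeff : Q.coeff k = ∏ j ∈ Finset.Icc 1 k, ρ j := by
    have := coeff_prod_of_natDegree_le (s := Finset.Icc 1 k)
      (f := fun j => (C (ρ j) * X + C (1 - γ j - ρ j) : ℝ[X])) 1 hdeg
    rw [mul_one, Nat.card_Icc, Nat.add_sub_cancel] at this
    rw [hQ, this]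
    refine Finset.prod_congr rfl fun j _ => ?_
    rw [coeff_add, coeff_C_mul, coeff_X_one, coeff_C_succ]
    ring
  have heval : ∀ x, Q.eval x = ∏ j ∈ Finset.Icc 1 k, (1 - γ j - ρ j * (1 - x)) := by
    intro x
    rw [hQ, eval_prod]
    refine Finset.prod_congr rfl fun j _ => ?_
    simp; ring
  have key := Lagrange.coeff_eq_sum hvs hQdeg
  rw [hcard, Nat.add_sub_cancel, hcoeff, Finset.sum_insert h0, Finset.erase_insert h0] at key
  have h1 : Q.eval (v 0) / ∏ j ∈ Finset.Icc 1 k, (v 0 - v j) = 1 := by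
    rw [heval, ← Finset.prod_div_distrib]
    refine Finset.prod_eq_one fun j hj => ?_
    simp only [Finset.mem_Icc] at hj
    simp only [hv, if_true, if_neg (show j ≠ 0 by omega)]
    have := hlt j hj.1 (by omega)
    rw [div_eq_one_iff_eq (by linarith)]
    ring
  have h2 : ∀ i ∈ Finset.Icc 1 k,
      Q.eval (v i) / ∏ j ∈ (insert 0 (Finset.Icc 1 k)).erase i, (v i - v j) =
        - ((1 - ρ i) * ∏ j ∈ (Finset.Icc 1 k).erase i,
          (1 - γ j - ρ j * (1 - γ i)) / (γ i - γ j)) := by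
    intro i hi
    have hi' := Finset.mem_Icc.1 hi
    have hγ := hlt i hi'.1 (by omega)
    rw [Finset.erase_insert_of_ne (by omega), Finset.prod_insert (by simp), heval,
      ← Finset.mul_prod_erase _ _ hi, Finset.prod_div_distrib]
    have hvi : v i = γ i := if_neg (by omega)
    have hv0 : v 0 = 1 := if_pos rfl
    have : ∏ j ∈ (Finset.Icc 1 k).erase i, (v i - v j) =
        ∏ j ∈ (Finset.Icc 1 k).erase i, (γ i - γ j) := by
      refine Finset.prod_congr rfl fun j hj => ?_
      have := (Finset.mem_Icc.1 (Finset.mem_of_mem_erase hj)).1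
      rw [hvi, show v j = γ j from if_neg (by omega)]
    rw [this, hvi, hv0]
    rw [← neg_mul, mul_div_mul_comm]
    have h3 : γ i - 1 ≠ 0 := by linarith
    have h4 : (1 - γ i - ρ i * (1 - γ i)) / (γ i - 1) = -(1 - ρ i) := by
      field_simp
      ring
    rw [h4]
  rw [h1, Finset.sum_congr rfl h2, Finset.sum_neg_distrib] at key
  linarith

lemma starDist_succ {r : ℕ} (ρ γ : ℕ → ℝ) {k : ℕ} {j : Fin (r + 1)} (hj : 1 ≤ (j : ℕ))
    (hjk : (j : ℕ) ≤ k) : starDist r ρ γ (k + 1) j = starDist r ρ γ k j *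
      ((1 - γ (k + 1) - ρ (k + 1) * (1 - γ j)) / (γ j - γ (k + 1))) := by
  have h : (Finset.Icc 1 (k + 1)).erase (j : ℕ) =
      insert (k + 1) ((Finset.Icc 1 k).erase (j : ℕ)) := by
    ext x
    simp only [Finset.mem_erase, Finset.mem_Icc, Finset.mem_insert]
    omega
  rw [starDist, starDist, if_neg (by omega), if_pos (by omega), if_neg (by omega),
    if_pos (by omega), h, Finset.prod_insert (by simp)]
  ring

lemma starDist_eq_nu {r : ℕ} {ρ : ℕ → ℝ} (γ : ℕ → ℝ) {i : ℕ} (hρ : ρ i ≠ 1) (j : Fin (r + 1)) :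
    starDist r ρ γ i j = ρ i * starDist r ρ γ (i - 1) j + (1 - ρ i) * nu r ρ γ i j := by
  have : 1 - ρ i ≠ 0 := sub_ne_zero.2 hρ.symm
  rw [nu]
  field_simp
  ring

lemma nu_zero {r : ℕ} (ρ γ : ℕ → ℝ) (i : ℕ) : nu r ρ γ (i + 1) 0 = 0 := by
  rw [nu, starDist_zero, starDist_zero, Finset.prod_Icc_succ_top (by omega)]
  simp [mul_comm]

/-- For `j ≤ i`, level `i + 1` adds one factor to entry `j`, and `(1 - γ_{i+1} - ρ_{i+1} (1 - γ_j))
- ρ_{i+1} (γ_j - γ_{i+1}) = (1 - ρ_{i+1}) (1 - γ_{i+1})`. The undivided form also covers `j = i +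
1`, where both sides vanish. -/
lemma nu_mul_sub {r : ℕ} {ρ γ : ℕ → ℝ}
    (hinj : ∀ i j, 1 ≤ i → i < j → j ≤ r → γ j < γ i) {i : ℕ} (hi : i + 1 ≤ r)
    (hρ : ρ (i + 1) ≠ 1) {j : Fin (r + 1)} (hj : 1 ≤ (j : ℕ)) :
    nu r ρ γ (i + 1) j * (γ j - γ (i + 1)) = (1 - γ (i + 1)) * starDist r ρ γ i j := by
  have h1 : 1 - ρ (i + 1) ≠ 0 := sub_ne_zero.2 hρ.symm
  rcases lt_trichotomy (j : ℕ) (i + 1) with h | h | h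
  · have h2 : γ j - γ (i + 1) ≠ 0 := by linarith [hinj j (i + 1) hj h hi]
    rw [nu, starDist_succ ρ γ hj (by omega), Nat.add_sub_cancel]
    field_simp
    ring
  · rw [h, sub_self, mul_zero, starDist_of_lt ρ γ (by omega), mul_zero]
  · rw [nu, starDist_of_lt ρ γ h, Nat.add_sub_cancel, starDist_of_lt ρ γ (by omega)]
    simp

lemma sum_nu {r : ℕ} {ρ γ : ℕ → ℝ}
    (hinj : ∀ i j, 1 ≤ i → i < j → j ≤ r → γ j < γ i) (hlt : ∀ i, 1 ≤ i → i ≤ r → γ i < 1)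
    {i : ℕ} (hi : i ≤ r) (hρ : ρ i ≠ 1) : ∑ j, nu r ρ γ i j = 1 := by
  have h1 : 1 - ρ i ≠ 0 := sub_ne_zero.2 hρ.symm
  simp only [nu]
  rw [← Finset.sum_div, Finset.sum_sub_distrib, ← Finset.mul_sum, sum_starDist hinj hlt hi,
    sum_starDist hinj hlt (by omega)]
  field_simp

/-- `π̂_k` is the law of the largest `l ≤ k` at which independent trials with success probabilities
`1 - ρ_l` succeed, and `0` if none does. Algebraically, the sum telescopes by induction on `k`. -/
lemma sum_hatDist {r : ℕ} (ρ : ℕ → ℝ) {k : ℕ} (hk : k ≤ r) : ∑ i, hatDist r ρ k i = 1 := by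
  unfold hatDist
  rw [sum_fin_ite_le hk _ (fun j => (1 - ρ j) * ∏ l ∈ Finset.Icc (j + 1) k, ρ l)]
  clear hk
  induction k with
  | zero => simp
  | succ k ih =>
    rw [Finset.sum_Icc_succ_top (by omega), Finset.prod_Icc_succ_top (by omega)]
    have : ∀ j ∈ Finset.Icc 1 k, (1 - ρ j) * ∏ l ∈ Finset.Icc (j + 1) (k + 1), ρ l =
        (1 - ρ j) * (∏ l ∈ Finset.Icc (j + 1) k, ρ l) * ρ (k + 1) := by
      intro j hj
      rw [Finset.prod_Icc_succ_top (by simp at hj; omega)]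
      ring
    rw [Finset.sum_congr rfl this, ← Finset.sum_mul]
    simp
    linear_combination ρ (k + 1) * ih

lemma hatDist_nonneg {r : ℕ} {ρ : ℕ → ℝ} (h0 : ∀ i, 1 ≤ i → i ≤ r → 0 ≤ ρ i)
    (h1 : ∀ i, 1 ≤ i → i ≤ r → ρ i ≤ 1) {k : ℕ} (hk : k ≤ r) (j : Fin (r + 1)) :
    0 ≤ hatDist r ρ k j := by
  unfold hatDist
  split_ifs with h h'
  · exact Finset.prod_nonneg fun i hi => h0 i (by simp at hi; omega) (by simp at hi; omega)
  · refine mul_nonneg (by linarith [h1 j (by omega) (by omega)]) ?_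
    exact Finset.prod_nonneg fun i hi => h0 i (by simp at hi; omega) (by simp at hi; omega)
  · exact le_rfl

lemma hatDist_succ {r : ℕ} (ρ : ℕ → ℝ) {k : ℕ} (hk : k + 1 ≤ r) (j : Fin (r + 1)) :
    hatDist r ρ (k + 1) j = ρ (k + 1) * hatDist r ρ k j +
      (1 - ρ (k + 1)) * (Pi.single (⟨k + 1, by omega⟩ : Fin (r + 1)) 1 : Fin (r + 1) → ℝ) j := by
  unfold hatDist
  rcases Nat.eq_zero_or_pos (j : ℕ) with h | h
  · have : j ≠ (⟨k + 1, by omega⟩ : Fin (r + 1)) := by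
      intro h'; rw [h'] at h; simp at h
    rw [if_pos h, if_pos h, Pi.single_eq_of_ne this, Finset.prod_Icc_succ_top (by omega)]
    ring
  · rw [if_neg h.ne', if_neg h.ne']
    rcases lt_trichotomy (j : ℕ) (k + 1) with h' | h' | h'
    · have : j ≠ (⟨k + 1, by omega⟩ : Fin (r + 1)) := by
        intro h''; rw [h''] at h'; simp at h'
      rw [if_pos h'.le, if_pos (Nat.le_of_lt_succ h'), Pi.single_eq_of_ne this,
        Finset.prod_Icc_succ_top (by omega)]
      ring
    · have : j = (⟨k + 1, by omega⟩ : Fin (r + 1)) := Fin.ext h'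
      rw [if_pos h'.le, if_neg (show ¬ (j : ℕ) ≤ k by omega), this, Pi.single_eq_same]
      simp
    · have : j ≠ (⟨k + 1, by omega⟩ : Fin (r + 1)) := by
        intro h''; rw [h''] at h'; simp at h'
      rw [if_neg (show ¬ (j : ℕ) ≤ k + 1 by omega), if_neg (show ¬ (j : ℕ) ≤ k by omega),
        Pi.single_eq_of_ne this]
      simp

lemma hatMatrix_zero {r : ℕ} (ρ γ : ℕ → ℝ) :
    hatMatrix r ρ γ 0 = Pi.single 0 1 := by
  ext j
  unfold hatMatrix
  rcases eq_or_ne j 0 with rfl | h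
  · simp
  · rw [if_pos (Fin.pos_iff_ne_zero.2 h), Pi.single_eq_of_ne h]

lemma hatMatrix_succ {r : ℕ} (ρ γ : ℕ → ℝ) {i : ℕ} (hi : i + 1 ≤ r) (j : Fin (r + 1)) :
    hatMatrix r ρ γ ⟨i + 1, by omega⟩ j = (1 - γ (i + 1)) * hatDist r ρ i j +
      γ (i + 1) * (Pi.single (⟨i + 1, by omega⟩ : Fin (r + 1)) 1 : Fin (r + 1) → ℝ) j := by
  have hz : ∀ j : Fin (r + 1), i < (j : ℕ) → hatDist r ρ i j = 0 := by
    intro j hj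
    rw [hatDist, if_neg (by omega), if_neg (by omega)]
  unfold hatMatrix
  rcases lt_trichotomy (⟨i + 1, by omega⟩ : Fin (r + 1)) j with h | h | h
  · rw [if_pos h, Pi.single_eq_of_ne h.ne', hz j (by rw [Fin.lt_def] at h; simp at h; omega)]
    simp
  · subst h
    rw [if_neg (lt_irrefl _), if_pos rfl, if_neg (by simp [Fin.ext_iff]), hz _ (by simp)]
    simp
  · rw [if_neg h.asymm, if_neg h.ne, Pi.single_eq_of_ne h.ne]
    simp

lemma hatMatrix_mem_rowStochastic {r : ℕ} {ρ γ : ℕ → ℝ} (h0 : ∀ i, 1 ≤ i → i ≤ r → 0 ≤ ρ i)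
    (h1 : ∀ i, 1 ≤ i → i ≤ r → ρ i ≤ 1) (hγ0 : ∀ i, 1 ≤ i → i ≤ r → 0 ≤ γ i)
    (hγ1 : ∀ i, 1 ≤ i → i ≤ r → γ i ≤ 1) :
    hatMatrix r ρ γ ∈ Matrix.rowStochastic ℝ (Fin (r + 1)) := by
  have hs : ∀ i j : Fin (r + 1), 0 ≤ (Pi.single i 1 : Fin (r + 1) → ℝ) j := fun i j => by
    rw [Pi.single_apply]; split_ifs <;> norm_num
  rw [Matrix.mem_rowStochastic_iff_sum]
  constructor
  · rintro ⟨_ | i, hi⟩ j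
    · rw [show (⟨0, hi⟩ : Fin (r + 1)) = 0 from rfl, hatMatrix_zero]
      exact hs _ _
    · rw [hatMatrix_succ ρ γ (by omega)]
      have h2 := hγ0 (i + 1) (by omega) (by omega)
      have := hγ1 (i + 1) (by omega) (by omega)
      exact add_nonneg (mul_nonneg (by linarith) (hatDist_nonneg h0 h1 (by omega) j))
        (mul_nonneg h2 (hs _ _))
  · rintro ⟨_ | i, hi⟩
    · rw [show (⟨0, hi⟩ : Fin (r + 1)) = 0 from rfl, hatMatrix_zero]
      simp
    · simp_rw [hatMatrix_succ ρ γ (show i + 1 ≤ r by omega)]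
      rw [Finset.sum_add_distrib, ← Finset.mul_sum, ← Finset.mul_sum, sum_hatDist ρ (by omega)]
      simp

lemma linkTwo_zero {r : ℕ} (ρ γ : ℕ → ℝ) : linkTwo r ρ γ 0 = Pi.single 0 1 := by
  simp [linkTwo]

lemma linkTwo_succ {r : ℕ} (ρ γ : ℕ → ℝ) {i : ℕ} (hi : i + 1 < r + 1) :
    linkTwo r ρ γ ⟨i + 1, hi⟩ = nu r ρ γ (i + 1) := by
  simp [linkTwo, Fin.ext_iff]

lemma matchesZero_linkTwo (r : ℕ) (ρ γ : ℕ → ℝ) : MatchesZero (linkTwo r ρ γ) := by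
  rintro ⟨_ | i, hi⟩
  · rw [show (⟨0, hi⟩ : Fin (r + 1)) = 0 from rfl, linkTwo_zero]
    simp
  · rw [linkTwo_succ, nu_zero, if_neg (by simp [Fin.ext_iff])]

/-- Both sides satisfy the same mixture recursion, because `Λ₂` sends `δ_{k+1}` to `ν_{k+1}`. All `k
≤ r` are needed, since row `k + 1` of `P̂` involves `π̂_k`. -/
lemma vecMul_hatDist_linkTwo {r : ℕ} {ρ : ℕ → ℝ} (γ : ℕ → ℝ) (hρ : ∀ i, 1 ≤ i → i ≤ r → ρ i ≠ 1)
    {k : ℕ} (hk : k ≤ r) :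
    Matrix.vecMul (hatDist r ρ k) (linkTwo r ρ γ) = starDist r ρ γ k := by
  induction k with
  | zero =>
    have h1 : hatDist r ρ 0 = Pi.single 0 1 := by
      ext j
      rw [hatDist, Pi.single_apply]
      by_cases h : j = 0
      · simp [h]
      · have : (j : ℕ) ≠ 0 := fun h' => h (Fin.ext h')
        simp [h]
    have h2 : starDist r ρ γ 0 = Pi.single 0 1 := by
      ext j
      rw [starDist, Pi.single_apply]
      by_cases h : j = 0
      · simp [h]
      · have : (j : ℕ) ≠ 0 := fun h' => h (Fin.ext h')
        simp [h]
    rw [h1, h2, Matrix.single_one_vecMul]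
    exact linkTwo_zero ρ γ
  | succ k ih =>
    have h1 : hatDist r ρ (k + 1) = ρ (k + 1) • hatDist r ρ k +
        (1 - ρ (k + 1)) • (Pi.single (⟨k + 1, by omega⟩ : Fin (r + 1)) 1 : Fin (r + 1) → ℝ) := by
      ext j
      simpa using hatDist_succ ρ hk j
    rw [h1, Matrix.add_vecMul, Matrix.smul_vecMul, Matrix.smul_vecMul, ih (by omega),
      Matrix.single_one_vecMul]
    ext j
    rw [starDist_eq_nu γ (hρ (k + 1) (by omega) hk)]
    have : (linkTwo r ρ γ).row ⟨k + 1, by omega⟩ = nu r ρ γ (k + 1) := linkTwo_succ ρ γ (by omega)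
    simp [this]

lemma absorb_zero {n : ℕ} (P : Matrix (Fin (n + 1)) (Fin (n + 1)) ℝ) :
    absorb P 0 = Pi.single 0 1 := by
  simp [absorb]

lemma absorb_ne {n : ℕ} (P : Matrix (Fin (n + 1)) (Fin (n + 1)) ℝ) {i : Fin (n + 1)}
    (hi : i ≠ 0) : absorb P i = P i := by
  simp [absorb, hi]

lemma absorb_hatMatrix {r : ℕ} (ρ γ : ℕ → ℝ) : absorb (hatMatrix r ρ γ) = hatMatrix r ρ γ := by
  rw [absorb, ← hatMatrix_zero ρ γ, Matrix.updateRow_eq_self]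

lemma absorb_starMatrix_ne {r : ℕ} (ρ γ : ℕ → ℝ) {i : Fin (r + 1)} (hi : i ≠ 0) :
    absorb (starMatrix r ρ γ) i =
      γ i • (Pi.single i 1 : Fin (r + 1) → ℝ) + (1 - γ i) • Pi.single 0 1 := by
  rw [absorb_ne _ hi]
  ext j
  simp only [starMatrix, if_neg hi, Pi.add_apply, Pi.smul_apply, smul_eq_mul, Pi.single_apply]
  by_cases h0 : j = 0
  · subst h0
    simp [hi.symm]
  · by_cases h1 : j = i
    · simp [h1, hi]
    · simp [h1, h0]

lemma vecMul_absorb_starMatrix {r : ℕ} (ρ γ : ℕ → ℝ) (v : Fin (r + 1) → ℝ) {j : Fin (r + 1)}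
    (hj : j ≠ 0) : Matrix.vecMul v (absorb (starMatrix r ρ γ)) j = v j * γ j := by
  rw [Matrix.vecMul, dotProduct, Finset.sum_eq_single j]
  · rw [absorb_starMatrix_ne ρ γ hj]
    simp [hj]
  · intro i _ hij
    by_cases hi : i = 0
    · rw [hi, absorb_zero]
      simp [hj]
    · rw [absorb_starMatrix_ne ρ γ hi]
      simp [hj, hij.symm]
  · simp

lemma absorb_starMatrix_row_sum {r : ℕ} (ρ γ : ℕ → ℝ) (i : Fin (r + 1)) :
    ∑ j, absorb (starMatrix r ρ γ) i j = 1 := by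
  by_cases hi : i = 0
  · simp [hi, absorb_zero]
  · rw [absorb_starMatrix_ne ρ γ hi]
    simp [Finset.sum_add_distrib, ← Finset.mul_sum]

lemma sum_vecMul {m k : ℕ} (v : Fin m → ℝ) {A : Matrix (Fin m) (Fin k) ℝ}
    (hA : ∀ i, ∑ j, A i j = 1) : ∑ j, Matrix.vecMul v A j = ∑ i, v i := by
  simp only [Matrix.vecMul, dotProduct]
  rw [Finset.sum_comm]
  simp [← Finset.mul_sum, hA]

/-- Lets every identity below be checked away from state `0` only: conservation of mass then settles
coordinate `0`. -/
lemma eq_of_sum_eq_of_ne_zero {m : ℕ} {v w : Fin (m + 1) → ℝ} (hs : ∑ j, v j = ∑ j, w j)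
    (h : ∀ j, j ≠ 0 → v j = w j) : v = w := by
  have h' : ∀ j : Fin m, v j.succ = w j.succ := fun j => h _ (Fin.succ_ne_zero j)
  rw [Fin.sum_univ_succ, Fin.sum_univ_succ, Finset.sum_congr rfl fun j _ => h' j] at hs
  ext j
  by_cases hj : j = 0
  · rw [hj]; linarith
  · exact h j hj

lemma nu_vecMul_absorb {r : ℕ} {ρ γ : ℕ → ℝ}
    (hinj : ∀ i j, 1 ≤ i → i < j → j ≤ r → γ j < γ i) (hlt : ∀ i, 1 ≤ i → i ≤ r → γ i < 1)
    {i : ℕ} (hi : i + 1 ≤ r) (hρ : ρ (i + 1) ≠ 1) :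
    Matrix.vecMul (nu r ρ γ (i + 1)) (absorb (starMatrix r ρ γ)) =
      (1 - γ (i + 1)) • starDist r ρ γ i + γ (i + 1) • nu r ρ γ (i + 1) := by
  refine eq_of_sum_eq_of_ne_zero ?_ fun j hj => ?_
  · rw [sum_vecMul _ (absorb_starMatrix_row_sum ρ γ), sum_nu hinj hlt hi hρ]
    simp [Finset.sum_add_distrib, ← Finset.mul_sum, sum_nu hinj hlt hi hρ,
      sum_starDist hinj hlt (show i ≤ r by omega)]
  · rw [vecMul_absorb_starMatrix ρ γ _ hj]
    have hj' : 1 ≤ (j : ℕ) := Nat.one_le_iff_ne_zero.2 fun h => hj (Fin.ext h)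
    have := nu_mul_sub hinj hi hρ hj'
    simp
    linarith

lemma isQuasiIntertwining_linkTwo {r : ℕ} {ρ γ : ℕ → ℝ}
    (hinj : ∀ i j, 1 ≤ i → i < j → j ≤ r → γ j < γ i) (hlt : ∀ i, 1 ≤ i → i ≤ r → γ i < 1)
    (hρ : ∀ i, 1 ≤ i → i ≤ r → ρ i ≠ 1) :
    IsQuasiIntertwining (linkTwo r ρ γ) (starDist r ρ γ r) (absorb (starMatrix r ρ γ))
      (hatDist r ρ r) (hatMatrix r ρ γ) where
  row_sum := by
    rintro ⟨_ | i, hi⟩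
    · rw [show (⟨0, hi⟩ : Fin (r + 1)) = 0 from rfl, linkTwo_zero]
      simp
    · rw [linkTwo_succ, sum_nu hinj hlt (by omega) (hρ (i + 1) (by omega) (by omega))]
  intertwine := by
    funext a
    obtain ⟨_ | i, hi⟩ := a
    · rw [show (⟨0, hi⟩ : Fin (r + 1)) = 0 from rfl, Matrix.mul_apply_eq_vecMul,
        Matrix.mul_apply_eq_vecMul, linkTwo_zero, hatMatrix_zero, Matrix.single_one_vecMul,
        Matrix.single_one_vecMul]
      exact (absorb_zero _).trans (linkTwo_zero ρ γ).symm
    · rw [Matrix.mul_apply_eq_vecMul, Matrix.mul_apply_eq_vecMul, linkTwo_succ,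
        nu_vecMul_absorb hinj hlt (by omega) (hρ (i + 1) (by omega) (by omega))]
      have h1 : hatMatrix r ρ γ ⟨i + 1, hi⟩ = (1 - γ (i + 1)) • hatDist r ρ i +
          γ (i + 1) • (Pi.single (⟨i + 1, hi⟩ : Fin (r + 1)) 1 : Fin (r + 1) → ℝ) := by
        ext j
        simpa using hatMatrix_succ ρ γ (by omega) j
      rw [h1, Matrix.add_vecMul, Matrix.smul_vecMul, Matrix.smul_vecMul,
        vecMul_hatDist_linkTwo γ hρ (by omega), Matrix.single_one_vecMul]
      rfl
  initial := (vecMul_hatDist_linkTwo γ hρ le_rfl).symm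

/-! ### Composition of quasi-intertwinings and absorption probabilities -/

lemma IsQuasiIntertwining.comp {l m n : ℕ} {Λ₁ : Matrix (Fin m) (Fin n) ℝ}
    {Λ₂ : Matrix (Fin l) (Fin m) ℝ} {π : Fin n → ℝ} {P : Matrix (Fin n) (Fin n) ℝ}
    {π' : Fin m → ℝ} {P' : Matrix (Fin m) (Fin m) ℝ} {π'' : Fin l → ℝ}
    {P'' : Matrix (Fin l) (Fin l) ℝ} (h₂ : IsQuasiIntertwining Λ₂ π' P' π'' P'')
    (h₁ : IsQuasiIntertwining Λ₁ π P π' P') : IsQuasiIntertwining (Λ₂ * Λ₁) π P π'' P'' where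
  row_sum i := by
    rw [Matrix.mul_apply_eq_vecMul, sum_vecMul _ h₁.row_sum, h₂.row_sum]
  intertwine := by
    rw [Matrix.mul_assoc, h₁.intertwine, ← Matrix.mul_assoc, h₂.intertwine, Matrix.mul_assoc]
  initial := by rw [h₁.initial, h₂.initial, Matrix.vecMul_vecMul]

lemma matchesZero_iff {m n : ℕ} {Λ : Matrix (Fin (m + 1)) (Fin (n + 1)) ℝ} :
    MatchesZero Λ ↔ Λ.mulVec (Pi.single 0 1) = Pi.single 0 1 := by
  simp [MatchesZero, funext_iff, Pi.single_apply]

lemma MatchesZero.comp {l m n : ℕ} {Λ₁ : Matrix (Fin (m + 1)) (Fin (n + 1)) ℝ}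
    {Λ₂ : Matrix (Fin (l + 1)) (Fin (m + 1)) ℝ} (h₂ : MatchesZero Λ₂) (h₁ : MatchesZero Λ₁) :
    MatchesZero (Λ₂ * Λ₁) := by
  rw [matchesZero_iff] at *
  rw [← Matrix.mulVec_mulVec, h₁, h₂]

lemma IsQuasiIntertwining.pow {m n : ℕ} {Λ : Matrix (Fin m) (Fin n) ℝ} {π : Fin n → ℝ}
    {P : Matrix (Fin n) (Fin n) ℝ} {π' : Fin m → ℝ} {P' : Matrix (Fin m) (Fin m) ℝ}
    (h : IsQuasiIntertwining Λ π P π' P') (t : ℕ) : Λ * P ^ t = P' ^ t * Λ := by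
  induction t with
  | zero => simp
  | succ t ih => rw [pow_succ, ← Matrix.mul_assoc, ih, Matrix.mul_assoc, h.intertwine,
      ← Matrix.mul_assoc, ← pow_succ]

/-- The transfer principle for hitting times. Only linear algebra enters, so negative entries of `Λ`
do no harm. -/
lemma IsQuasiIntertwining.vecMul_pow_zero {m n : ℕ} {Λ : Matrix (Fin (m + 1)) (Fin (n + 1)) ℝ}
    {π : Fin (n + 1) → ℝ} {P : Matrix (Fin (n + 1)) (Fin (n + 1)) ℝ} {π' : Fin (m + 1) → ℝ}
    {P' : Matrix (Fin (m + 1)) (Fin (m + 1)) ℝ} (h : IsQuasiIntertwining Λ π P π' P')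
    (h0 : MatchesZero Λ) (t : ℕ) :
    Matrix.vecMul π (P ^ t) 0 = Matrix.vecMul π' (P' ^ t) 0 := by
  rw [h.initial, Matrix.vecMul_vecMul, h.pow, ← Matrix.vecMul_vecMul]
  have : (Matrix.vecMul (Matrix.vecMul π' (P' ^ t)) Λ) 0 =
      Matrix.vecMul π' (P' ^ t) ⬝ᵥ Λ.mulVec (Pi.single 0 1) := by
    rw [Matrix.dotProduct_mulVec]
    simp
  rw [this, matchesZero_iff.1 h0]
  simp

/-! ### Consequences of strict interlacing -/

/-- The strict interlacing `1 = λ₀ > γ₁ > λ₁ > ⋯ > γ_r > λ_r`. -/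
structure StrictlyInterlaced (r : ℕ) (lam γ : ℕ → ℝ) : Prop where
  lam_zero : lam 0 = 1
  lam_lt : ∀ i, 1 ≤ i → i ≤ r → lam i < γ i
  lt_lam : ∀ i, 1 ≤ i → i ≤ r → γ i < lam (i - 1)

namespace StrictlyInterlaced

variable {r : ℕ} {lam γ ρ : ℕ → ℝ} (h : StrictlyInterlaced r lam γ)
include h

lemma lam_le_lam {i j : ℕ} (hij : i ≤ j) (hj : j ≤ r) : lam j ≤ lam i := by
  induction j, hij using Nat.le_induction with
  | base => exact le_rfl
  | succ j hij ih =>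
    have h1 := h.lam_lt (j + 1) (by omega) hj
    have h2 := h.lt_lam (j + 1) (by omega) hj
    rw [Nat.add_sub_cancel] at h2
    linarith [ih (by omega)]

lemma gam_lt_lam {i j : ℕ} (hij : i < j) (hj : j ≤ r) : γ j < lam i :=
  (h.lt_lam j (by omega) hj).trans_le (h.lam_le_lam (by omega) (by omega))

lemma gam_lt_gam (i j : ℕ) (hi : 1 ≤ i) (hij : i < j) (hj : j ≤ r) : γ j < γ i :=
  (h.gam_lt_lam hij hj).trans (h.lam_lt i hi (by omega))

lemma gam_lt_one (i : ℕ) (hi : 1 ≤ i) (hir : i ≤ r) : γ i < 1 :=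
  h.lam_zero ▸ h.gam_lt_lam hi hir

lemma lam_lt_one (i : ℕ) (hi : 1 ≤ i) (hir : i ≤ r) : lam i < 1 :=
  (h.lam_lt i hi hir).trans (h.gam_lt_one i hi hir)

lemma gam_pos (h0 : 0 ≤ lam r) (i : ℕ) (hi : 1 ≤ i) (hir : i ≤ r) : 0 < γ i :=
  (h0.trans (h.lam_le_lam hir le_rfl)).trans_lt (h.lam_lt i hi hir)

lemma rho_mul (hρ : ∀ i, ρ i = (1 - γ i) / (1 - lam i)) (i : ℕ) (hi : 1 ≤ i) (hir : i ≤ r) :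
    ρ i * (1 - lam i) = 1 - γ i := by
  have := h.lam_lt_one i hi hir
  rw [hρ, div_mul_cancel₀ _ (by linarith)]

lemma rho_pos (hρ : ∀ i, ρ i = (1 - γ i) / (1 - lam i)) (i : ℕ) (hi : 1 ≤ i) (hir : i ≤ r) :
    0 < ρ i := by
  have := h.lam_lt_one i hi hir
  have := h.gam_lt_one i hi hir
  rw [hρ]
  exact div_pos (by linarith) (by linarith)

lemma rho_lt_one (hρ : ∀ i, ρ i = (1 - γ i) / (1 - lam i)) (i : ℕ) (hi : 1 ≤ i) (hir : i ≤ r) :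
    ρ i < 1 := by
  have := h.lam_lt_one i hi hir
  have := h.lam_lt i hi hir
  rw [hρ, div_lt_one (by linarith)]
  linarith

lemma starDist_pos (hρ : ∀ i, ρ i = (1 - γ i) / (1 - lam i)) {k : ℕ} (hk : k ≤ r)
    {j : Fin (r + 1)} (hj : 1 ≤ (j : ℕ)) (hjk : (j : ℕ) ≤ k) : 0 < starDist r ρ γ k j := by
  rw [starDist, if_neg (by omega), if_pos hjk]
  refine mul_pos (by linarith [h.rho_lt_one hρ j hj (by omega)]) (Finset.prod_pos fun l hl => ?_)
  simp only [Finset.mem_erase, Finset.mem_Icc] at hl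
  -- In this form the factor is `ρ_l (γ_j - λ_l) / (γ_j - γ_l)`. Interlacing puts `λ_l` and `γ_l` on
  -- the same side of `γ_j` when `l ≠ j`, so the quotient is positive.
  have h1 : 1 - γ l - ρ l * (1 - γ j) = ρ l * (γ j - lam l) := by
    linear_combination -h.rho_mul hρ l hl.2.1 (by omega)
  have h2 := h.rho_pos hρ l hl.2.1 (by omega)
  rw [h1]
  rcases lt_or_gt_of_ne hl.1 with h3 | h3
  · have h4 := h.gam_lt_lam h3 (by omega)
    have h5 := h.gam_lt_gam l j hl.2.1 h3 (by omega)
    exact div_pos_of_neg_of_neg (mul_neg_of_pos_of_neg h2 (by linarith)) (by linarith)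
  · have h4 := h.lam_lt l hl.2.1 (by omega)
    have h5 := h.gam_lt_gam j l hj h3 (by omega)
    exact div_pos (mul_pos h2 (by linarith)) (by linarith)

lemma linkTwo_nonneg (hρ : ∀ i, ρ i = (1 - γ i) / (1 - lam i)) (i j : Fin (r + 1)) :
    0 ≤ linkTwo r ρ γ i j := by
  obtain ⟨_ | i, hi⟩ := i
  · rw [show (⟨0, hi⟩ : Fin (r + 1)) = 0 from rfl, linkTwo_zero, Pi.single_apply]
    split_ifs <;> norm_num
  rw [linkTwo_succ]
  have hρi := h.rho_lt_one hρ (i + 1) (by omega) (by omega)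
  rcases Nat.eq_zero_or_pos (j : ℕ) with hj | hj
  · rw [show j = 0 from Fin.ext hj, nu_zero]
  · rcases lt_trichotomy (j : ℕ) (i + 1) with h1 | h1 | h1
    · have h2 := nu_mul_sub h.gam_lt_gam (show i + 1 ≤ r by omega) hρi.ne hj
      have h3 := h.gam_lt_gam j (i + 1) hj h1 (by omega)
      have h4 := h.gam_lt_one (i + 1) (by omega) (by omega)
      refine nonneg_of_mul_nonneg_left (b := γ j - γ (i + 1)) ?_ (by linarith)
      rw [h2]
      exact mul_nonneg (by linarith) (h.starDist_pos hρ (by omega) hj (by omega)).le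
    · rw [nu, Nat.add_sub_cancel, starDist_of_lt ρ γ (show i < (j : ℕ) by omega), mul_zero,
        sub_zero]
      exact div_nonneg (h.starDist_pos hρ (by omega) hj (by omega)).le (by linarith)
    · rw [nu, starDist_of_lt ρ γ h1, Nat.add_sub_cancel, starDist_of_lt ρ γ (by omega)]
      simp

/-- Here `p` stands for `π(0)` and `a` for the weight of `π` in the `γ_i`-eigenspace; `h1` and `h2`
are the values of the secular polynomial at `1` and at `γ_i`. The first forces `p = ∏ ρ_j`, after
which the second can be solved for `a`. -/
lemma starDist_eq (hρ : ∀ i, ρ i = (1 - γ i) / (1 - lam i)) {i : Fin (r + 1)}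
    (hi : 1 ≤ (i : ℕ)) {a p : ℝ}
    (h1 : ∏ j ∈ Finset.Icc 1 r, (1 - γ j) = p * ∏ j ∈ Finset.Icc 1 r, (1 - lam j))
    (h2 : (1 - γ i) * a * ∏ j ∈ (Finset.Icc 1 r).erase i, (γ i - γ j) =
      p * ∏ j ∈ Finset.Icc 1 r, (γ i - lam j)) : starDist r ρ γ r i = a := by
  have hir : (i : ℕ) ≤ r := by omega
  have hmem : (i : ℕ) ∈ Finset.Icc 1 r := Finset.mem_Icc.2 ⟨hi, hir⟩
  have hp : p = ∏ j ∈ Finset.Icc 1 r, ρ j := by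
    have : ∏ j ∈ Finset.Icc 1 r, (1 - γ j) =
        (∏ j ∈ Finset.Icc 1 r, ρ j) * ∏ j ∈ Finset.Icc 1 r, (1 - lam j) := by
      rw [← Finset.prod_mul_distrib]
      refine Finset.prod_congr rfl fun j hj => ?_
      rw [Finset.mem_Icc] at hj
      exact (h.rho_mul hρ j hj.1 hj.2).symm
    rw [this] at h1
    refine (mul_right_cancel₀ (Finset.prod_ne_zero_iff.2 fun j hj => ?_) h1).symm
    rw [Finset.mem_Icc] at hj
    linarith [h.lam_lt_one j hj.1 hj.2]
  have h3 : ∀ j ∈ (Finset.Icc 1 r).erase (i : ℕ), (1 - γ j - ρ j * (1 - γ i)) / (γ i - γ j) =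
      ρ j * (γ i - lam j) / (γ i - γ j) := by
    intro j hj
    simp only [Finset.mem_erase, Finset.mem_Icc] at hj
    congr 1
    linear_combination -h.rho_mul hρ j hj.2.1 hj.2.2
  have hD : ∏ j ∈ (Finset.Icc 1 r).erase (i : ℕ), (γ i - γ j) ≠ 0 := by
    refine Finset.prod_ne_zero_iff.2 fun j hj => ?_
    simp only [Finset.mem_erase, Finset.mem_Icc] at hj
    rcases lt_or_gt_of_ne hj.1 with h4 | h4
    · linarith [h.gam_lt_gam j i hj.2.1 h4 hir]
    · linarith [h.gam_lt_gam i j hi h4 hj.2.2]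
  have hγ := h.gam_lt_one i hi hir
  rw [starDist, if_neg (by omega), if_pos hir, Finset.prod_congr rfl h3, Finset.prod_div_distrib,
    Finset.prod_mul_distrib, ← mul_div_assoc, div_eq_iff hD]
  rw [hp, ← Finset.mul_prod_erase _ (fun j => γ i - lam j) hmem,
    ← Finset.mul_prod_erase _ ρ hmem] at h2
  have h5 : 1 - γ i ≠ 0 := by linarith
  refine mul_left_cancel₀ h5 ?_
  rw [← mul_assoc (1 - γ i) a, h2, ← h.rho_mul hρ i hi hir]
  have h6 : γ i - lam i = (1 - ρ i) * (1 - lam i) := by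
    linear_combination h.rho_mul hρ i hi hir
  rw [h6]
  ring

end StrictlyInterlaced

/-! ### Eigenframes -/

/-- Some power `P^k` is entrywise positive and `π = π P^k`. -/
lemma IsReversibleErgodic.pos {n : ℕ} {P : Matrix (Fin (n + 1)) (Fin (n + 1)) ℝ}
    {π : Fin (n + 1) → ℝ} (hP : IsReversibleErgodic P π) (i : Fin (n + 1)) : 0 < π i := by
  obtain ⟨k, -, hk⟩ := hP.ergodic.exists_pos_pow
  have hπ : ∀ k : ℕ, Matrix.vecMul π (P ^ k) = π := by
    intro k
    induction k with
    | zero => simp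
    | succ k ih => rw [pow_succ, ← Matrix.vecMul_vecMul, ih, hP.stationary]
  obtain ⟨h0, h1⟩ := hP.distribution
  obtain ⟨j, -, hj⟩ := Finset.exists_ne_zero_of_sum_ne_zero (h1.trans_ne one_ne_zero)
  rw [← hπ k]
  exact Finset.sum_pos' (fun l _ => mul_nonneg (h0 l) (hk l i).le)
    ⟨j, Finset.mem_univ j, mul_pos ((h0 j).lt_of_ne' hj) (hk j i)⟩

lemma IsReversibleErgodic.sum_succ {n : ℕ} {P : Matrix (Fin (n + 1)) (Fin (n + 1)) ℝ}
    {π : Fin (n + 1) → ℝ} (hP : IsReversibleErgodic P π) : ∑ m : Fin n, π m.succ = 1 - π 0 := by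
  have := hP.distribution.2
  rw [Fin.sum_univ_succ] at this
  linarith

/-- Reversibility says precisely that `D₀^{1/2} P₀ D₀^{-1/2}` is symmetric, so the spectral theorem
applies. -/
lemma exists_isEigenframe {n : ℕ} {P : Matrix (Fin (n + 1)) (Fin (n + 1)) ℝ}
    {π : Fin (n + 1) → ℝ} (hP : IsReversibleErgodic P π) : ∃ U η, IsEigenframe P π U η := by
  have hA : (Matrix.diagonal (fun m : Fin n => √(π m.succ)) * deleteZero P *
      Matrix.diagonal (fun m : Fin n => (√(π m.succ))⁻¹)).IsHermitian := by
    refine Matrix.IsHermitian.ext fun i j => ?_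
    simp only [Matrix.mul_diagonal, Matrix.diagonal_mul, deleteZero, Matrix.submatrix_apply,
      star_trivial]
    have hi := Real.sqrt_pos.2 (hP.pos i.succ)
    have hj := Real.sqrt_pos.2 (hP.pos j.succ)
    have h := hP.reversible i.succ j.succ
    field_simp
    rw [Real.sq_sqrt (hP.pos _).le, Real.sq_sqrt (hP.pos _).le]
    linarith
  refine ⟨star (hA.eigenvectorUnitary : Matrix (Fin n) (Fin n) ℝ), hA.eigenvalues, ?_, ?_⟩
  · have := Unitary.coe_star_mul_self hA.eigenvectorUnitary
    rwa [Matrix.star_eq_conjTranspose, Matrix.conjTranspose_eq_transpose_of_trivial] at *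
  · have h1 := hA.conjStarAlgAut_star_eigenvectorUnitary
    rw [Unitary.conjStarAlgAut_star_apply] at h1
    rw [Matrix.star_eq_conjTranspose, Matrix.conjTranspose_eq_transpose_of_trivial] at *
    simpa using h1

namespace IsEigenframe

variable {n : ℕ} {P : Matrix (Fin (n + 1)) (Fin (n + 1)) ℝ} {π : Fin (n + 1) → ℝ}
  {U : Matrix (Fin n) (Fin n) ℝ} {η : Fin n → ℝ} (hU : IsEigenframe P π U η)
include hU

lemma transpose_mul : U.transpose * U = 1 :=
  mul_eq_one_comm.1 hU.orthogonal

lemma mul_deleteZero (hP : IsReversibleErgodic P π) :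
    U * Matrix.diagonal (fun m : Fin n => √(π m.succ)) * deleteZero P =
      Matrix.diagonal η * (U * Matrix.diagonal (fun m : Fin n => √(π m.succ))) := by
  have hD : Matrix.diagonal (fun m : Fin n => (√(π m.succ))⁻¹) *
      Matrix.diagonal (fun m : Fin n => √(π m.succ)) = 1 := by
    rw [Matrix.diagonal_mul_diagonal, ← Matrix.diagonal_one]
    congr 1
    funext m
    exact inv_mul_cancel₀ (Real.sqrt_pos.2 (hP.pos _)).ne'
  rw [← hU.eigen]
  simp only [Matrix.mul_assoc]
  rw [← Matrix.mul_assoc U.transpose U, hU.transpose_mul, Matrix.one_mul, hD, Matrix.mul_one]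

omit hU in
lemma mul_diagonal_row (π : Fin (n + 1) → ℝ) (U : Matrix (Fin n) (Fin n) ℝ) (k : Fin n) :
    (U * Matrix.diagonal (fun m : Fin n => √(π m.succ))) k = eigRow π U k := by
  funext m
  simp [Matrix.mul_diagonal, eigRow]

lemma eigRow_vecMul (hP : IsReversibleErgodic P π) (k : Fin n) :
    Matrix.vecMul (eigRow π U k) (deleteZero P) = η k • eigRow π U k := by
  have := congrFun (hU.mul_deleteZero hP) k
  rw [Matrix.mul_apply_eq_vecMul, mul_diagonal_row] at this
  rw [this]
  funext m
  rw [Matrix.diagonal_mul, mul_diagonal_row]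
  rfl

omit hU in
-- The total mass of `u_k` is its own coefficient in `(π(1), …, π(n))`; this is where the squares
-- `a_k²` come from.
lemma sum_eigRow (π : Fin (n + 1) → ℝ) (U : Matrix (Fin n) (Fin n) ℝ) (k : Fin n) :
    ∑ m, eigRow π U k m = eigCoord π U k :=
  Finset.sum_congr rfl fun _ _ => mul_comm _ _

/-- Expansion of the vector with entries `√π(m)` in the orthonormal rows of `U`, multiplied
entrywise by `√π(m)`. -/
lemma sum_eigCoord_mul_eigRow (hP : IsReversibleErgodic P π) (m : Fin n) :
    ∑ k, eigCoord π U k * eigRow π U k m = π m.succ := by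
  have h : ∀ l : Fin n, ∑ k, U k l * U k m = if l = m then 1 else 0 := by
    intro l
    have := congrFun (congrFun hU.transpose_mul l) m
    rwa [Matrix.mul_apply, Matrix.one_apply] at this
  simp only [eigCoord, eigRow, Finset.sum_mul]
  rw [Finset.sum_comm]
  have : ∀ l : Fin n, ∑ k, √(π l.succ) * U k l * (U k m * √(π m.succ)) =
      if l = m then √(π l.succ) * √(π m.succ) else 0 := by
    intro l
    rw [← mul_boole, ← h l, Finset.mul_sum]
    exact Finset.sum_congr rfl fun k _ => by ring
  simp only [this, Finset.sum_ite_eq', Finset.mem_univ, if_true]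
  exact Real.mul_self_sqrt (hP.pos _).le

lemma sum_eigCoord_sq (hP : IsReversibleErgodic P π) : ∑ k, eigCoord π U k ^ 2 = 1 - π 0 := by
  rw [← hP.sum_succ, ← Finset.sum_congr rfl fun m _ => hU.sum_eigCoord_mul_eigRow hP m,
    Finset.sum_comm]
  refine Finset.sum_congr rfl fun k _ => ?_
  rw [← Finset.mul_sum, sum_eigRow, sq]

end IsEigenframe

/-! ### The quasi-link to the star chain -/

section linkOne

variable {n r : ℕ} {P : Matrix (Fin (n + 1)) (Fin (n + 1)) ℝ} {π : Fin (n + 1) → ℝ}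
  {U : Matrix (Fin n) (Fin n) ℝ} {η : Fin n → ℝ} {ρ γ : ℕ → ℝ}

lemma linkOne_row_zero : linkOne r ρ γ π U η 0 = Pi.single 0 1 := by
  simp [linkOne]

lemma linkOne_apply_zero {i : Fin (r + 1)} (hi : i ≠ 0) : linkOne r ρ γ π U η i 0 =
    1 - (∑ k with η k = γ i, eigCoord π U k ^ 2) / starDist r ρ γ r i := by
  rw [linkOne, if_neg hi, Pi.add_apply, Finset.sum_apply]
  simp_rw [Pi.smul_apply, Fin.cons_zero, IsEigenframe.sum_eigRow, smul_eq_mul, mul_neg]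
  rw [Finset.sum_neg_distrib, Pi.single_eq_same, ← sub_eq_add_neg, Finset.sum_div]
  congr 1
  exact Finset.sum_congr rfl fun k _ => by ring

lemma linkOne_apply_succ {i : Fin (r + 1)} (hi : i ≠ 0) (m : Fin n) :
    linkOne r ρ γ π U η i m.succ =
      ∑ k with η k = γ i, eigCoord π U k / starDist r ρ γ r i * eigRow π U k m := by
  rw [linkOne, if_neg hi, Pi.add_apply, Finset.sum_apply,
    Pi.single_eq_of_ne (Fin.succ_ne_zero m), zero_add]
  exact Finset.sum_congr rfl fun k _ => by rw [Pi.smul_apply, Fin.cons_succ, smul_eq_mul]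

lemma linkOne_row_sum (i : Fin (r + 1)) : ∑ j, linkOne r ρ γ π U η i j = 1 := by
  by_cases hi : i = 0
  · simp [hi, linkOne_row_zero]
  · rw [Fin.sum_univ_succ, linkOne_apply_zero hi]
    simp_rw [linkOne_apply_succ hi]
    rw [Finset.sum_comm, Finset.sum_div]
    simp_rw [← Finset.mul_sum, IsEigenframe.sum_eigRow]
    rw [sub_add, ← Finset.sum_sub_distrib, Finset.sum_eq_zero, sub_zero]
    intro k _
    ring

lemma absorb_row_sum (hP : P ∈ Matrix.rowStochastic ℝ (Fin (n + 1))) (i : Fin (n + 1)) :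
    ∑ j, absorb P i j = 1 := by
  by_cases hi : i = 0
  · simp [hi, absorb_zero]
  · rw [absorb_ne P hi]
    exact Matrix.sum_row_of_mem_rowStochastic hP i

/-- Away from `0` the row combines left eigenvectors of `P₀` that all have eigenvalue `γ_i`. The
right-hand side is row `i` of the absorbed star matrix applied to `Λ₁`. -/
lemma linkOne_vecMul_absorb (hP : IsReversibleErgodic P π) (hU : IsEigenframe P π U η)
    {i : Fin (r + 1)} (hi : i ≠ 0) : Matrix.vecMul (linkOne r ρ γ π U η i) (absorb P) =
      γ i • linkOne r ρ γ π U η i + (1 - γ i) • Pi.single 0 1 := by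
  refine eq_of_sum_eq_of_ne_zero ?_ fun j hj => ?_
  · rw [sum_vecMul _ (absorb_row_sum hP.stochastic), linkOne_row_sum]
    simp [Finset.sum_add_distrib, ← Finset.mul_sum, linkOne_row_sum]
  · obtain ⟨m, rfl⟩ := Fin.exists_succ_eq.2 hj
    rw [Matrix.vecMul, dotProduct, Fin.sum_univ_succ, absorb_zero, Pi.single_eq_of_ne hj, mul_zero,
      zero_add]
    simp only [linkOne_apply_succ hi, absorb_ne P (Fin.succ_ne_zero _), Pi.add_apply,
      Pi.smul_apply, smul_eq_mul, Pi.single_eq_of_ne hj, mul_zero, add_zero, Finset.sum_mul]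
    rw [Finset.sum_comm, Finset.mul_sum]
    refine Finset.sum_congr rfl fun k hk => ?_
    have h1 := congrFun (hU.eigRow_vecMul hP k) m
    rw [(Finset.mem_filter.1 hk).2] at h1
    simp only [Matrix.vecMul, dotProduct, deleteZero, Matrix.submatrix_apply, Pi.smul_apply,
      smul_eq_mul] at h1
    simp_rw [mul_assoc]
    rw [← Finset.mul_sum, h1]
    ring

lemma matchesZero_linkOne
    (hstar : ∀ i : Fin (r + 1), i ≠ 0 → starDist r ρ γ r i ≠ 0)
    (hA : ∀ i : Fin (r + 1), i ≠ 0 →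
      starDist r ρ γ r i = ∑ k with η k = γ i, eigCoord π U k ^ 2) :
    MatchesZero (linkOne r ρ γ π U η) := by
  intro i
  by_cases hi : i = 0
  · simp [hi, linkOne_row_zero]
  · rw [linkOne_apply_zero hi, ← hA i hi, div_self (hstar i hi), sub_self, if_neg hi]

lemma isQuasiIntertwining_linkOne (hP : IsReversibleErgodic P π) (hU : IsEigenframe P π U η)
    (hstar : ∀ i : Fin (r + 1), i ≠ 0 → starDist r ρ γ r i ≠ 0)
    (hsum : ∑ i, starDist r ρ γ r i = 1)
    (hinj : ∀ i j : Fin (r + 1), i ≠ 0 → j ≠ 0 → γ i = γ j → i = j)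
    (hzero : ∀ k, (∀ i : Fin (r + 1), i ≠ 0 → η k ≠ γ i) → eigCoord π U k = 0) :
    IsQuasiIntertwining (linkOne r ρ γ π U η) π (absorb P)
      (starDist r ρ γ r) (absorb (starMatrix r ρ γ)) where
  row_sum := linkOne_row_sum
  intertwine := by
    funext i
    rw [Matrix.mul_apply_eq_vecMul, Matrix.mul_apply_eq_vecMul]
    by_cases hi : i = 0
    · rw [hi, linkOne_row_zero, absorb_zero, Matrix.single_one_vecMul, Matrix.single_one_vecMul]
      exact (absorb_zero P).trans linkOne_row_zero.symm
    · rw [linkOne_vecMul_absorb hP hU hi, absorb_starMatrix_ne ρ γ hi, Matrix.add_vecMul,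
        Matrix.smul_vecMul, Matrix.smul_vecMul, Matrix.single_one_vecMul,
        Matrix.single_one_vecMul]
      rw [show (linkOne r ρ γ π U η).row 0 = Pi.single 0 1 from linkOne_row_zero]
      rfl
  initial := by
    refine eq_of_sum_eq_of_ne_zero ?_ fun j hj => ?_
    · rw [sum_vecMul _ linkOne_row_sum, hsum]
      exact hP.distribution.2
    · obtain ⟨m, rfl⟩ := Fin.exists_succ_eq.2 hj
      rw [← hU.sum_eigCoord_mul_eigRow hP m, Matrix.vecMul, dotProduct, Fin.sum_univ_succ,
        linkOne_row_zero, Pi.single_eq_of_ne hj, mul_zero, zero_add]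
      have h1 : ∀ i : Fin r, starDist r ρ γ r i.succ * linkOne r ρ γ π U η i.succ m.succ =
          ∑ k, if η k = γ i.succ then eigCoord π U k * eigRow π U k m else 0 := by
        intro i
        rw [linkOne_apply_succ (Fin.succ_ne_zero i), Finset.mul_sum, ← Finset.sum_filter]
        refine Finset.sum_congr rfl fun k _ => ?_
        have := hstar i.succ (Fin.succ_ne_zero i)
        field_simp
      rw [Finset.sum_congr rfl fun i _ => h1 i, Finset.sum_comm]
      -- The spectral expansion of `π` is regrouped by eigenvalue. Each `k` is counted once because
      -- the `γ_i` are distinct, and a `k` whose eigenvalue is no `γ_i` has coefficient zero.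
      refine Finset.sum_congr rfl fun k _ => ?_
      by_cases hk : ∃ i : Fin (r + 1), i ≠ 0 ∧ η k = γ i
      · obtain ⟨i, hi, hik⟩ := hk
        obtain ⟨i, rfl⟩ := Fin.exists_succ_eq.2 hi
        rw [Finset.sum_eq_single i, if_pos hik]
        · intro j _ hji
          refine if_neg fun hjk => hji ?_
          exact Fin.succ_injective _
            (hinj _ _ (Fin.succ_ne_zero j) hi (hjk.symm.trans hik))
        · simp
      · push Not at hk
        rw [hzero k hk]
        simp

end linkOne

/-! ### Hitting times of Markov chains -/

/-- Points are closed and every subset is countable. This allows measures on `ℕ∞` to be compared on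
the half-lines `Iic`. -/
instance borelSpace_enat : BorelSpace ℕ∞ where
  measurable_eq := by
    refine le_antisymm (fun s _ => ?_) le_top
    have hs : ∀ a : ℕ∞, MeasurableSet[borel ℕ∞] {a} := fun a => by
      refine MeasurableSet.of_compl ?_
      exact MeasurableSpace.measurableSet_generateFrom (isClosed_singleton (x := a)).isOpen_compl
    rw [← Set.biUnion_of_singleton s]
    exact MeasurableSet.biUnion (m := borel ℕ∞) (Set.to_countable s) fun a _ => hs a

lemma identDistrib_of_measure_le_eq {Ω Ω' : Type*} [MeasurableSpace Ω] [MeasurableSpace Ω']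
    {μ : Measure Ω} {μ' : Measure Ω'} [IsProbabilityMeasure μ] [IsProbabilityMeasure μ']
    {T : Ω → ℕ∞} {T' : Ω' → ℕ∞} (hT : AEMeasurable T μ) (hT' : AEMeasurable T' μ')
    (h : ∀ t : ℕ, μ {ω | T ω ≤ t} = μ' {ω | T' ω ≤ t}) : IdentDistrib T T' μ μ' where
  aemeasurable_fst := hT
  aemeasurable_snd := hT'
  map_eq := by
    have := Measure.isProbabilityMeasure_map hT
    have hle : ∀ t : ℕ, μ.map T (Set.Iic (t : ℕ∞)) = μ'.map T' (Set.Iic (t : ℕ∞)) := by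
      intro t
      rw [Measure.map_apply_of_aemeasurable hT .of_discrete,
        Measure.map_apply_of_aemeasurable hT' .of_discrete]
      exact h t
    refine Measure.ext_of_Iic _ _ fun a => ?_
    induction a using ENat.recTopCoe with
    | top =>
      rw [show Set.Iic (⊤ : ℕ∞) = Set.univ from Set.Iic_top,
        Measure.map_apply_of_aemeasurable hT .univ, Measure.map_apply_of_aemeasurable hT' .univ]
      simp
    | coe t => exact hle t

section MarkovChain

variable {Ω : Type*} [MeasurableSpace Ω] {μ : Measure Ω} {n : ℕ} {X : ℕ → Ω → Fin (n + 1)}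
  {π : Fin (n + 1) → ℝ} {P : Matrix (Fin (n + 1)) (Fin (n + 1)) ℝ}

/-- The Markov property, conditionally on any event that depends on the first `t + 1` states. -/
lemma IsMarkovChain.measure_inter (hX : IsMarkovChain μ X π P)
    (hP : P ∈ Matrix.rowStochastic ℝ (Fin (n + 1))) (t : ℕ)
    (S : Finset (Fin (t + 1) → Fin (n + 1))) {i : Fin (n + 1)} (hS : ∀ x ∈ S, x (Fin.last t) = i)
    (j : Fin (n + 1)) :
    μ ({ω | (fun s : Fin (t + 1) => X s ω) ∈ S} ∩ {ω | X (t + 1) ω = j}) =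
      μ {ω | (fun s : Fin (t + 1) => X s ω) ∈ S} * ENNReal.ofReal (P i j) := by
  set Z : Ω → Fin (t + 1) → Fin (n + 1) := fun ω s => X s ω with hZ
  have hZm : Measurable Z := measurable_pi_lambda _ fun s => hX.measurable s
  have hms : ∀ x, MeasurableSet (Z ⁻¹' {x}) := fun x => hZm (MeasurableSet.singleton x)
  have hmj : MeasurableSet {ω | X (t + 1) ω = j} :=
    hX.measurable (t + 1) (MeasurableSet.singleton j)
  have h1 := sum_measure_preimage_singleton (μ := μ) S fun x _ => hms x
  have h2 := sum_measure_preimage_singleton (μ := μ.restrict {ω | X (t + 1) ω = j}) S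
    fun x _ => hms x
  have hSm : MeasurableSet (Z ⁻¹' ↑S) := hZm S.measurableSet
  rw [Measure.restrict_apply hSm] at h2
  change μ (Z ⁻¹' ↑S ∩ _) = μ (Z ⁻¹' ↑S) * _
  rw [← h1, ← h2, Finset.sum_mul]
  refine Finset.sum_congr rfl fun x hx => ?_
  rw [Measure.restrict_apply (hms x)]
  -- `hX.law` takes paths indexed by all of `ℕ`, so the finite path `x` is continued by `j`; only
  -- the value at `t + 1` matters.
  set y : ℕ → Fin (n + 1) := fun s => if hs : s < t + 1 then x ⟨s, hs⟩ else j with hy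
  have hyt : y t = i := by
    rw [← hS x hx, hy]
    exact dif_pos (Nat.lt_succ_self t)
  have hyj : y (t + 1) = j := dif_neg (lt_irrefl _)
  have hy' : ∀ s (hs : s < t + 1), y s = x ⟨s, hs⟩ := fun s hs => dif_pos hs
  have e1 : Z ⁻¹' {x} = {ω | ∀ s ≤ t, X s ω = y s} := by
    ext ω
    simp only [Set.mem_preimage, Set.mem_singleton_iff, Set.mem_ofPred_eq, hZ, funext_iff]
    constructor
    · intro h s hs
      rw [hy' s (by omega)]
      exact h ⟨s, by omega⟩
    · rintro h ⟨s, hs⟩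
      rw [← hy' s hs]
      exact h s (by omega)
  have e2 : Z ⁻¹' {x} ∩ {ω | X (t + 1) ω = j} = {ω | ∀ s ≤ t + 1, X s ω = y s} := by
    rw [e1]
    ext ω
    simp only [Set.mem_inter_iff, Set.mem_ofPred_eq]
    constructor
    · rintro ⟨h, hj⟩ s hs
      rcases Nat.lt_or_ge t s with h' | h'
      · rw [show s = t + 1 by omega, hj, hyj]
      · exact h s h'
    · intro h
      exact ⟨fun s hs => h s (by omega), (h (t + 1) le_rfl).trans hyj⟩
  rw [e2, e1, hX.law, hX.law, Finset.prod_range_succ, ← mul_assoc, hyt, hyj,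
    ENNReal.ofReal_mul' (Matrix.nonneg_of_mem_rowStochastic hP)]

lemma absorb_mem_rowStochastic (hP : P ∈ Matrix.rowStochastic ℝ (Fin (n + 1))) :
    absorb P ∈ Matrix.rowStochastic ℝ (Fin (n + 1)) := by
  refine Matrix.mem_rowStochastic_iff_sum.2 ⟨fun i j => ?_, absorb_row_sum hP⟩
  by_cases hi : i = 0
  · rw [hi, absorb_zero, Pi.single_apply]
    split_ifs <;> norm_num
  · rw [absorb_ne P hi]
    exact Matrix.nonneg_of_mem_rowStochastic hP

/-- A path of the absorbed chain that ends at `j ≠ 0` has never met `0`, and until then both chains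
have the same transitions. The induction splits over the state at time `t`. -/
lemma IsMarkovChain.measure_avoid (hX : IsMarkovChain μ X π P)
    (hP : P ∈ Matrix.rowStochastic ℝ (Fin (n + 1))) (hπ : ∀ i, 0 ≤ π i) (t : ℕ)
    {j : Fin (n + 1)} (hj : j ≠ 0) :
    μ {ω | X t ω = j ∧ ∀ s ≤ t, X s ω ≠ 0} =
      ENNReal.ofReal (Matrix.vecMul π (absorb P ^ t) j) := by
  classical
  induction t generalizing j with
  | zero =>
    have : {ω | X 0 ω = j ∧ ∀ s ≤ 0, X s ω ≠ 0} = {ω | ∀ s ≤ 0, X s ω = (fun _ => j) s} := by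
      ext ω
      simp only [Set.mem_ofPred_eq, Nat.le_zero, forall_eq]
      exact ⟨fun h => h.1, fun h => ⟨h, h ▸ hj⟩⟩
    rw [this, hX.law]
    simp
  | succ t ih =>
    have hv : ∀ i, 0 ≤ Matrix.vecMul π (absorb P ^ t) i :=
      Matrix.nonneg_vecMul_of_mem_rowStochastic
        (Submonoid.pow_mem _ (absorb_mem_rowStochastic hP) t) hπ
    have hm : ∀ i s, MeasurableSet {ω | X s ω = i} :=
      fun i s => hX.measurable s (MeasurableSet.singleton i)
    have hmav : ∀ u, MeasurableSet {ω | ∀ s ≤ u, X s ω ≠ 0} := by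
      intro u
      have : {ω | ∀ s ≤ u, X s ω ≠ 0} = ⋂ s, ⋂ (_ : s ≤ u), {ω | X s ω = 0}ᶜ := by
        ext ω; simp
      rw [this]
      exact .iInter fun s => .iInter fun _ => (hm 0 s).compl
    have key : ∀ i : Fin (n + 1), i ≠ 0 →
        μ ({ω | X t ω = i ∧ ∀ s ≤ t, X s ω ≠ 0} ∩ {ω | X (t + 1) ω = j}) =
          ENNReal.ofReal (Matrix.vecMul π (absorb P ^ t) i * P i j) := by
      intro i hi
      have hset : {ω | X t ω = i ∧ ∀ s ≤ t, X s ω ≠ 0} =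
          {ω | (fun s : Fin (t + 1) => X s ω) ∈ (Finset.univ.filter
            fun x : Fin (t + 1) → Fin (n + 1) => x (Fin.last t) = i ∧ ∀ s, x s ≠ 0)} := by
        ext ω
        simp only [Set.mem_ofPred_eq, Finset.mem_filter, Finset.mem_univ, true_and, Fin.val_last]
        refine and_congr_right fun _ => ⟨fun h s => h s (by omega), fun h s hs => ?_⟩
        exact h ⟨s, by omega⟩
      rw [ENNReal.ofReal_mul (hv i), ← ih hi, hset]
      exact hX.measure_inter hP t _ (fun x hx => (Finset.mem_filter.1 hx).2.1) j
    have hunion : {ω | X (t + 1) ω = j ∧ ∀ s ≤ t + 1, X s ω ≠ 0} =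
        ⋃ i ∈ Finset.univ.erase (0 : Fin (n + 1)),
          ({ω | X t ω = i ∧ ∀ s ≤ t, X s ω ≠ 0} ∩ {ω | X (t + 1) ω = j}) := by
      ext ω
      simp only [Set.mem_ofPred_eq, Finset.mem_erase, Finset.mem_univ, and_true, Set.mem_iUnion,
        Set.mem_inter_iff, exists_prop]
      constructor
      · rintro ⟨h1, h2⟩
        exact ⟨X t ω, h2 t (by omega), ⟨rfl, fun s hs => h2 s (by omega)⟩, h1⟩
      · rintro ⟨i, _, ⟨_, h2⟩, h1⟩
        refine ⟨h1, fun s hs => ?_⟩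
        rcases Nat.lt_or_ge t s with h' | h'
        · rw [show s = t + 1 by omega, h1]
          exact hj
        · exact h2 s h'
    rw [hunion, measure_biUnion_finset]
    · rw [Finset.sum_congr rfl fun i hi => key i (Finset.ne_of_mem_erase hi),
        ← ENNReal.ofReal_sum_of_nonneg fun i _ => mul_nonneg (hv i)
          (Matrix.nonneg_of_mem_rowStochastic hP)]
      congr 1
      rw [pow_succ, ← Matrix.vecMul_vecMul, Matrix.vecMul, dotProduct,
        ← Finset.add_sum_erase _ _ (Finset.mem_univ 0), absorb_zero, Pi.single_eq_of_ne hj,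
        mul_zero, zero_add]
      exact Finset.sum_congr rfl fun i hi => by rw [absorb_ne P (Finset.ne_of_mem_erase hi)]
    · intro i _ i' _ hii
      refine Set.disjoint_left.2 ?_
      rintro ω ⟨⟨h1, -⟩, -⟩ ⟨⟨h2, -⟩, -⟩
      exact hii (h1.symm.trans h2)
    · intro i _
      exact ((hm i t).inter (hmav t)).inter (hm j (t + 1))

omit [MeasurableSpace Ω] in
lemma hitZero_le_iff (X : ℕ → Ω → Fin (n + 1)) (t : ℕ) (ω : Ω) :
    hitZero X ω ≤ t ↔ ∃ s ≤ t, X s ω = 0 := by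
  refine (hittingAfter_le_iff (u := X) (s := {0}) (n := 0) (i := t) (ω := ω)).trans ?_
  simp

lemma IsMarkovChain.measurable_hitZero (hX : IsMarkovChain μ X π P) :
    Measurable (hitZero X) := by
  refine measurable_of_Iic fun a => ?_
  induction a using ENat.recTopCoe with
  | top =>
    rw [show Set.Iic (⊤ : ℕ∞) = Set.univ from Set.Iic_top]
    exact MeasurableSet.univ
  | coe t =>
    have : hitZero X ⁻¹' Set.Iic (t : ℕ∞) = ⋃ s, ⋃ (_ : s ≤ t), X s ⁻¹' {0} := by
      ext ω
      simpa using hitZero_le_iff X t ω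
    exact this ▸ .iUnion fun s => .iUnion fun _ => hX.measurable s (MeasurableSet.singleton 0)

lemma IsMarkovChain.measure_hitZero_le (hX : IsMarkovChain μ X π P)
    (hP : P ∈ Matrix.rowStochastic ℝ (Fin (n + 1))) (hπ : π ∈ stdSimplex ℝ (Fin (n + 1)))
    (t : ℕ) :
    μ {ω | hitZero X ω ≤ t} = ENNReal.ofReal (Matrix.vecMul π (absorb P ^ t) 0) := by
  classical
  have := hX.isProbabilityMeasure
  have hm : ∀ i s, MeasurableSet {ω | X s ω = i} :=
    fun i s => hX.measurable s (MeasurableSet.singleton i)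
  have hpow := Submonoid.pow_mem _ (absorb_mem_rowStochastic hP) t
  have hv := Matrix.nonneg_vecMul_of_mem_rowStochastic hpow hπ.1
  have hmT : MeasurableSet {ω | hitZero X ω ≤ t} := hX.measurable_hitZero measurableSet_Iic
  have hcompl : {ω | hitZero X ω ≤ t}ᶜ = ⋃ i ∈ Finset.univ.erase (0 : Fin (n + 1)),
      {ω | X t ω = i ∧ ∀ s ≤ t, X s ω ≠ 0} := by
    ext ω
    simp only [Set.mem_compl_iff, Set.mem_ofPred_eq, hitZero_le_iff, not_exists, not_and,
      Finset.mem_erase, Finset.mem_univ, and_true, Set.mem_iUnion, exists_prop]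
    exact ⟨fun h => ⟨X t ω, h t le_rfl, rfl, h⟩, fun ⟨_, _, _, h⟩ => h⟩
  have hmav : MeasurableSet {ω | ∀ s ≤ t, X s ω ≠ 0} := by
    have : {ω | ∀ s ≤ t, X s ω ≠ 0} = ⋂ s, ⋂ (_ : s ≤ t), {ω | X s ω = 0}ᶜ := by
      ext ω; simp
    rw [this]
    exact .iInter fun s => .iInter fun _ => (hm 0 s).compl
  have h1 : μ {ω | hitZero X ω ≤ t}ᶜ =
      ENNReal.ofReal (1 - Matrix.vecMul π (absorb P ^ t) 0) := by
    rw [hcompl, measure_biUnion_finset]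
    · rw [Finset.sum_congr rfl fun i hi =>
          hX.measure_avoid hP hπ.1 t (Finset.ne_of_mem_erase hi),
        ← ENNReal.ofReal_sum_of_nonneg fun i _ => hv i]
      congr 1
      have hs := sum_vecMul π (Matrix.sum_row_of_mem_rowStochastic hpow)
      rw [hπ.2, ← Finset.add_sum_erase _ _ (Finset.mem_univ 0)] at hs
      linarith
    · intro i _ i' _ hii
      refine Set.disjoint_left.2 ?_
      rintro ω ⟨h1, -⟩ ⟨h2, -⟩
      exact hii (h1.symm.trans h2)
    · intro i _
      exact (hm i t).inter hmav
  have hle : Matrix.vecMul π (absorb P ^ t) 0 ≤ 1 := by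
    rw [← hπ.2, ← sum_vecMul π (Matrix.sum_row_of_mem_rowStochastic hpow)]
    exact Finset.single_le_sum (fun i _ => hv i) (Finset.mem_univ 0)
  have h2 := prob_compl_eq_one_sub (μ := μ) hmT.compl
  rw [compl_compl, h1] at h2
  rw [h2, ← ENNReal.ofReal_one, ← ENNReal.ofReal_sub _ (by linarith)]
  congr 1
  ring

end MarkovChain

/-! ### Sums of independent modified geometric variables -/

lemma hatMatrix_pow_zero {r : ℕ} (ρ γ : ℕ → ℝ) (t : ℕ) :
    (hatMatrix r ρ γ ^ t) 0 = Pi.single 0 1 := by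
  induction t with
  | zero => funext j; simp [Matrix.one_apply, Pi.single_apply, eq_comm]
  | succ t ih =>
    rw [pow_succ, Matrix.mul_apply_eq_vecMul, ih, Matrix.single_one_vecMul]
    exact hatMatrix_zero ρ γ

lemma hatMatrix_pow_succ_apply {r : ℕ} (ρ γ : ℕ → ℝ) {k : ℕ} (hk : k + 1 ≤ r) (t : ℕ) :
    (hatMatrix r ρ γ ^ (t + 1)) ⟨k + 1, by omega⟩ 0 =
      (1 - γ (k + 1)) * Matrix.vecMul (hatDist r ρ k) (hatMatrix r ρ γ ^ t) 0 +
        γ (k + 1) * (hatMatrix r ρ γ ^ t) ⟨k + 1, by omega⟩ 0 := by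
  have h1 : hatMatrix r ρ γ ⟨k + 1, by omega⟩ = (1 - γ (k + 1)) • hatDist r ρ k +
      γ (k + 1) • (Pi.single (⟨k + 1, by omega⟩ : Fin (r + 1)) 1 : Fin (r + 1) → ℝ) := by
    ext j
    simpa using hatMatrix_succ ρ γ hk j
  rw [pow_succ', Matrix.mul_apply_eq_vecMul, h1, Matrix.add_vecMul, Matrix.smul_vecMul,
    Matrix.smul_vecMul, Matrix.single_one_vecMul]
  rfl

/-- Decomposition by the exit time `s + 1` from state `k + 1`, after which the chain restarts from
`π̂_k`. -/
lemma hatMatrix_pow_apply {r : ℕ} (ρ γ : ℕ → ℝ) {k : ℕ} (hk : k + 1 ≤ r) (t : ℕ) :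
    (hatMatrix r ρ γ ^ t) ⟨k + 1, by omega⟩ 0 =
      ∑ s ∈ Finset.range t, γ (k + 1) ^ s * (1 - γ (k + 1)) *
        Matrix.vecMul (hatDist r ρ k) (hatMatrix r ρ γ ^ (t - (s + 1))) 0 := by
  induction t with
  | zero => simp [Fin.ext_iff]
  | succ t ih =>
    rw [hatMatrix_pow_succ_apply ρ γ hk, ih, Finset.sum_range_succ', add_comm, Finset.mul_sum]
    congr 1
    · refine Finset.sum_congr rfl fun s _ => ?_
      rw [show t + 1 - (s + 1 + 1) = t - (s + 1) by omega]
      ring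
    · simp

/-- The coefficients are the masses of `modifiedGeo` at `0` and at `s + 1`, so the right side is a
convolution. -/
lemma vecMul_hatDist_succ {r : ℕ} (ρ γ : ℕ → ℝ) {k : ℕ} (hk : k + 1 ≤ r) (t : ℕ) :
    Matrix.vecMul (hatDist r ρ (k + 1)) (hatMatrix r ρ γ ^ t) 0 =
      ρ (k + 1) * Matrix.vecMul (hatDist r ρ k) (hatMatrix r ρ γ ^ t) 0 +
        ∑ s ∈ Finset.range t, (1 - ρ (k + 1)) * (γ (k + 1) ^ s * (1 - γ (k + 1))) *
          Matrix.vecMul (hatDist r ρ k) (hatMatrix r ρ γ ^ (t - (s + 1))) 0 := by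
  have h1 : hatDist r ρ (k + 1) = ρ (k + 1) • hatDist r ρ k +
      (1 - ρ (k + 1)) • (Pi.single (⟨k + 1, by omega⟩ : Fin (r + 1)) 1 : Fin (r + 1) → ℝ) := by
    ext j
    simpa using hatDist_succ ρ hk j
  rw [h1, Matrix.add_vecMul, Matrix.smul_vecMul, Matrix.smul_vecMul, Matrix.single_one_vecMul,
    Pi.add_apply, Pi.smul_apply, Pi.smul_apply, smul_eq_mul, smul_eq_mul]
  congr 1
  rw [show (hatMatrix r ρ γ ^ t).row ⟨k + 1, by omega⟩ 0 = _ from hatMatrix_pow_apply ρ γ hk t,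
    Finset.mul_sum]
  exact Finset.sum_congr rfl fun s _ => by ring

lemma geo_apply_zero (p : ℝ) : geo p {0} = 0 := by
  rw [geo, Measure.map_apply .of_discrete (MeasurableSet.singleton 0)]
  convert measure_empty (μ := geometricMeasure (Set.projIcc 0 1 zero_le_one p))
  ext k
  simp

lemma geo_apply_succ {p : ℝ} (h0 : 0 < p) (h1 : p ≤ 1) (k : ℕ) :
    geo p {k + 1} = ENNReal.ofReal ((1 - p) ^ k * p) := by
  have hp : Set.projIcc 0 1 zero_le_one p = ⟨p, h0.le, h1⟩ := Set.projIcc_of_mem _ ⟨h0.le, h1⟩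
  rw [geo, Measure.map_apply .of_discrete (MeasurableSet.singleton _), hp]
  have : (fun x : ℕ => x + 1) ⁻¹' {k + 1} = {k} := by ext x; simp
  rw [this, geometricMeasure_singleton]
  intro h
  exact h0.ne' (congrArg Subtype.val h)

lemma modifiedGeo_apply_zero (ρ p : ℝ) : modifiedGeo ρ p {0} = ENNReal.ofReal ρ := by
  simp [modifiedGeo, geo_apply_zero]

lemma modifiedGeo_apply_succ {ρ p : ℝ} (hρ : ρ ≤ 1) (h0 : 0 < p) (h1 : p ≤ 1) (k : ℕ) :
    modifiedGeo ρ p {k + 1} = ENNReal.ofReal ((1 - ρ) * ((1 - p) ^ k * p)) := by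
  rw [ENNReal.ofReal_mul (by linarith), ← geo_apply_succ h0 h1]
  simp [modifiedGeo]

/-- The distribution function of a sum of two independent variables, split by the value of the
second one. -/
lemma measure_add_le {Ω : Type*} [MeasurableSpace Ω] {μ : Measure Ω}
    {S Y : Ω → ℕ} (hS : AEMeasurable S μ) (hY : AEMeasurable Y μ) (h : IndepFun S Y μ) (t : ℕ) :
    μ {ω | S ω + Y ω ≤ t} =
      ∑ k ∈ Finset.range (t + 1), μ.map Y {k} * μ {ω | S ω ≤ t - k} := by
  have hunion : {ω | S ω + Y ω ≤ t} =
      ⋃ k ∈ Finset.range (t + 1), (S ⁻¹' Set.Iic (t - k) ∩ Y ⁻¹' {k}) := by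
    ext ω
    simp only [Set.mem_ofPred_eq, Finset.mem_range, Set.mem_iUnion, Set.mem_inter_iff,
      Set.mem_preimage, Set.mem_Iic, Set.mem_singleton_iff, exists_prop]
    constructor
    · intro h
      exact ⟨Y ω, by omega, by omega, rfl⟩
    · rintro ⟨k, hk, h1, h2⟩
      omega
  rw [hunion, measure_biUnion_finset₀]
  · refine Finset.sum_congr rfl fun k _ => ?_
    rw [h.measure_inter_preimage_eq_mul _ _ .of_discrete .of_discrete, mul_comm,
      Measure.map_apply_of_aemeasurable hY .of_discrete]
    rfl
  · intro i _ j _ hij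
    refine (Set.disjoint_left.2 ?_).aedisjoint
    rintro ω ⟨-, h1⟩ ⟨-, h2⟩
    exact hij (h1.symm.trans h2)
  · intro k _
    exact (hS.nullMeasurable .of_discrete).inter (hY.nullMeasurable .of_discrete)

lemma measure_sum_modifiedGeo_le {r : ℕ} {ρ γ : ℕ → ℝ}
    (hρ0 : ∀ i, 1 ≤ i → i ≤ r → 0 ≤ ρ i) (hρ1 : ∀ i, 1 ≤ i → i ≤ r → ρ i ≤ 1)
    (hγ0 : ∀ i, 1 ≤ i → i ≤ r → 0 ≤ γ i) (hγ1 : ∀ i, 1 ≤ i → i ≤ r → γ i < 1)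
    {Ω : Type*} [MeasurableSpace Ω] {μ : Measure Ω} [IsProbabilityMeasure μ] {Y : Fin r → Ω → ℕ}
    (hY : iIndepFun Y μ)
    (hlaw : ∀ i : Fin r,
      HasLaw (Y i) (modifiedGeo (ρ ((i : ℕ) + 1)) (1 - γ ((i : ℕ) + 1))) μ)
    {k : ℕ} (hk : k ≤ r) (t : ℕ) :
    μ {ω | ∑ i with (i : Fin r).val < k, Y i ω ≤ t} =
      ENNReal.ofReal (Matrix.vecMul (hatDist r ρ k) (hatMatrix r ρ γ ^ t) 0) := by
  classical
  have hae : ∀ i, AEMeasurable (Y i) μ := fun i => (hlaw i).aemeasurable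
  induction k generalizing t with
  | zero =>
    have h1 : hatDist r ρ 0 = Pi.single 0 1 := by
      ext j
      rw [hatDist, Pi.single_apply]
      by_cases h : j = 0
      · simp [h]
      · have : (j : ℕ) ≠ 0 := fun h' => h (Fin.ext h')
        simp [h]
    rw [h1, Matrix.single_one_vecMul,
      show (hatMatrix r ρ γ ^ t).row 0 = Pi.single 0 1 from hatMatrix_pow_zero ρ γ t]
    simp
  | succ k ih =>
    have hG : ∀ t, 0 ≤ Matrix.vecMul (hatDist r ρ k) (hatMatrix r ρ γ ^ t) 0 := by
      intro t
      refine Matrix.nonneg_vecMul_of_mem_rowStochastic (Submonoid.pow_mem _ ?_ t)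
        (fun i => hatDist_nonneg hρ0 hρ1 (by omega) i) 0
      exact hatMatrix_mem_rowStochastic hρ0 hρ1 hγ0 fun i h1 h2 => (hγ1 i h1 h2).le
    -- The variables are numbered from `0` and their parameters from `1`: `Y i₀` has parameters `ρ
    -- (k + 1)` and `1 - γ (k + 1)`.
    set i₀ : Fin r := ⟨k, by omega⟩ with hi₀
    set A : Finset (Fin r) := Finset.univ.filter fun i => (i : ℕ) < k with hA
    have hnot : i₀ ∉ A := by simp [hA, hi₀]
    have hins : (Finset.univ.filter fun i : Fin r => (i : ℕ) < k + 1) = insert i₀ A := by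
      ext i
      simp only [hA, hi₀, Finset.mem_filter, Finset.mem_univ, true_and, Finset.mem_insert,
        Fin.ext_iff]
      omega
    have hset : {ω | ∑ i with (i : Fin r).val < k + 1, Y i ω ≤ t} =
        {ω | (∑ i ∈ A, Y i) ω + Y i₀ ω ≤ t} := by
      ext ω
      rw [Set.mem_ofPred_eq, Set.mem_ofPred_eq, hins, Finset.sum_insert hnot, Finset.sum_apply,
        add_comm]
    have hS : ∀ t, μ {ω | (∑ i ∈ A, Y i) ω ≤ t} =
        ENNReal.ofReal (Matrix.vecMul (hatDist r ρ k) (hatMatrix r ρ γ ^ t) 0) := by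
      intro t
      rw [← ih (by omega) t]
      simp only [Finset.sum_apply, hA]
    have h1ρ := hρ1 (k + 1) (by omega) hk
    have h0γ := hγ0 (k + 1) (by omega) hk
    have h1γ := hγ1 (k + 1) (by omega) hk
    rw [hset, measure_add_le (A.aemeasurable_sum fun i _ => hae i) (hae i₀)
      (hY.indepFun_finsetSum_of_notMem₀ hae hnot), (hlaw i₀).map_eq, Finset.sum_range_succ',
      vecMul_hatDist_succ ρ γ hk, add_comm, modifiedGeo_apply_zero, hS, Nat.sub_zero,
      ← ENNReal.ofReal_mul (hρ0 (k + 1) (by omega) hk)]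
    have hterm : ∀ s, 0 ≤ (1 - ρ (k + 1)) * (γ (k + 1) ^ s * (1 - γ (k + 1))) := fun s =>
      mul_nonneg (by linarith) (mul_nonneg (pow_nonneg h0γ s) (by linarith))
    rw [ENNReal.ofReal_add (mul_nonneg (hρ0 (k + 1) (by omega) hk) (hG t))
      (Finset.sum_nonneg fun s _ => mul_nonneg (hterm s) (hG _)),
      ENNReal.ofReal_sum_of_nonneg fun s _ => mul_nonneg (hterm s) (hG _)]
    congr 1
    refine Finset.sum_congr rfl fun s _ => ?_
    rw [modifiedGeo_apply_succ h1ρ (by simp only [hi₀]; linarith) (by simp only [hi₀]; linarith),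
      hS, ENNReal.ofReal_mul (hterm s)]
    simp only [hi₀, sub_sub_cancel]

/-! ### Real roots interlacing a sequence of sign changes -/

/-- Exactly the `i - 1` factors with `j < i` are negative. -/
lemma sign_prod_sub_pos {r : ℕ} {g : ℕ → ℝ}
    (hg : ∀ i j, 1 ≤ i → i < j → j ≤ r → g j < g i) {i : ℕ} (hi : i ∈ Finset.Icc 1 r) :
    0 < (-1) ^ (i - 1) * ∏ j ∈ (Finset.Icc 1 r).erase i, (g i - g j) := by
  have hi' := Finset.mem_Icc.1 hi
  have h1 : (-1 : ℝ) ^ (i - 1) = ∏ j ∈ (Finset.Icc 1 r).erase i, if j < i then -1 else 1 := by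
    rw [Finset.prod_ite, Finset.prod_const, Finset.prod_const_one, mul_one]
    have : ((Finset.Icc 1 r).erase i).filter (fun j => j < i) = Finset.Ico 1 i := by
      ext j
      simp only [Finset.mem_filter, Finset.mem_erase, Finset.mem_Icc, Finset.mem_Ico]
      omega
    rw [this, Nat.card_Ico]
  rw [h1, ← Finset.prod_mul_distrib]
  refine Finset.prod_pos fun j hj => ?_
  simp only [Finset.mem_erase, Finset.mem_Icc] at hj
  split_ifs with h
  · linarith [hg j i hj.2.1 h hi'.2]
  · linarith [hg i j hi'.1 (by omega) hj.2.2]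

open Polynomial in
-- Near `-∞` the sign of `G` is `(-1)^r`: the polynomial `(-1)^r G(-x)` has positive leading
-- coefficient, so it tends to `+∞`.
lemma exists_lt_sign_eval_neg {G : ℝ[X]} {r : ℕ} (hr : 1 ≤ r) (hdeg : G.natDegree = r)
    (hlead : 0 < G.leadingCoeff) (b : ℝ) : ∃ x < b, (-1) ^ (r - 1) * G.eval x < 0 := by
  set H : ℝ[X] := C ((-1) ^ r) * G.comp (-X) with hH
  have hHl : H.leadingCoeff = G.leadingCoeff := by
    rw [hH, leadingCoeff_mul, leadingCoeff_C, leadingCoeff_comp (by simp), hdeg]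
    have : ((-1 : ℝ) ^ r) * (-1) ^ r = 1 := by rw [← mul_pow]; simp
    simp only [leadingCoeff_neg, leadingCoeff_X]
    linear_combination G.leadingCoeff * this
  have hHd : 0 < H.degree := by
    rw [← natDegree_pos_iff_degree_pos, hH, natDegree_C_mul (by simp), natDegree_comp, hdeg]
    simpa [Nat.pos_iff_ne_zero] using Nat.one_le_iff_ne_zero.1 hr
  have ht := H.tendsto_atTop_of_leadingCoeff_nonneg hHd (hHl ▸ hlead.le)
  obtain ⟨x, hx1, hx2⟩ := ((ht.eventually_gt_atTop 0).and
    (Filter.eventually_gt_atTop (-b))).exists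
  refine ⟨-x, by linarith, ?_⟩
  simp only [hH, eval_mul, eval_C, eval_comp, eval_neg, eval_X] at hx1
  obtain ⟨s, rfl⟩ : ∃ s, r = s + 1 := ⟨r - 1, by omega⟩
  rw [pow_succ] at hx1
  rw [Nat.add_sub_cancel]
  linarith

open Polynomial in
/-- A polynomial of degree `r` with alternating signs along a decreasing sequence of length `r` has
`r` real roots, one below each term of the sequence and above the next. -/
lemma exists_interlacing_roots {r : ℕ} {g : ℕ → ℝ}
    (hg : ∀ i j, 1 ≤ i → i < j → j ≤ r → g j < g i) {G : ℝ[X]} (hdeg : G.natDegree = r)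
    (hlead : 0 < G.leadingCoeff)
    (hsign : ∀ i ∈ Finset.Icc 1 r,
      0 < G.eval (g i) * ∏ j ∈ (Finset.Icc 1 r).erase i, (g i - g j)) :
    ∃ l : ℕ → ℝ, (∀ i, 1 ≤ i → i ≤ r → l i < g i) ∧ (∀ i, 1 ≤ i → i < r → g (i + 1) < l i) ∧
      G.roots = (Finset.Icc 1 r).val.map l ∧
      G = C G.leadingCoeff * ∏ i ∈ Finset.Icc 1 r, (X - C (l i)) := by
  classical
  have hpos : ∀ i ∈ Finset.Icc 1 r, 0 < (-1) ^ (i - 1) * G.eval (g i) := by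
    intro i hi
    have h1 := mul_pos (hsign i hi) (sign_prod_sub_pos hg hi)
    set e := ∏ j ∈ (Finset.Icc 1 r).erase i, (g i - g j)
    have h2 : 0 < ((-1) ^ (i - 1) * G.eval (g i)) * e ^ 2 := by
      calc 0 < G.eval (g i) * e * ((-1) ^ (i - 1) * e) := h1
        _ = _ := by ring
    exact pos_of_mul_pos_left h2 (sq_nonneg e)
  have hroot : ∀ i, 1 ≤ i → i ≤ r →
      ∃ x, x < g i ∧ (i < r → g (i + 1) < x) ∧ G.eval x = 0 := by
    intro i h1 h2
    -- The left endpoint of the sign change is the next node, or for `i = r` a point far to the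
    -- left.
    obtain ⟨y, hy, hyg, hyn⟩ : ∃ y < g i, (i < r → y = g (i + 1)) ∧
        (-1) ^ (i - 1) * G.eval y < 0 := by
      rcases h2.lt_or_eq with h | h
      · refine ⟨g (i + 1), hg i (i + 1) h1 (by omega) h, fun _ => rfl, ?_⟩
        have := hpos (i + 1) (Finset.mem_Icc.2 ⟨by omega, h⟩)
        obtain ⟨s, rfl⟩ : ∃ s, i = s + 1 := ⟨i - 1, by omega⟩
        simp only [Nat.add_sub_cancel, pow_succ] at this ⊢
        linarith
      · obtain ⟨y, hy, hyn⟩ := exists_lt_sign_eval_neg (h ▸ h1) hdeg hlead (g i)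
        exact ⟨y, hy, fun h' => absurd h h'.ne, h ▸ hyn⟩
    have hcont : ContinuousOn (fun x => (-1) ^ (i - 1) * G.eval x) (Set.Icc y (g i)) :=
      (continuous_const.mul G.continuous).continuousOn
    obtain ⟨x, hx, hx0⟩ := intermediate_value_Ioo hy.le hcont
      (show (0 : ℝ) ∈ _ from ⟨hyn, hpos i (Finset.mem_Icc.2 ⟨h1, h2⟩)⟩)
    refine ⟨x, hx.2, fun h => hyg h ▸ hx.1, ?_⟩
    exact (mul_eq_zero.1 hx0).resolve_left (pow_ne_zero _ (by norm_num))
  choose! l hl1 hl2 hl3 using hroot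
  have hG : G ≠ 0 := fun h => by simp [h] at hlead
  have hanti : ∀ i j, 1 ≤ i → i < j → j ≤ r → l j < l i := by
    intro i j hi hij hj
    have h1 : g j ≤ g (i + 1) := by
      rcases Nat.lt_or_ge (i + 1) j with h | h
      · exact (hg (i + 1) j (by omega) h hj).le
      · rw [show j = i + 1 by omega]
    linarith [hl1 j (by omega) hj, hl2 i hi (by omega) (by omega)]
  have hnodup : ((Finset.Icc 1 r).val.map l).Nodup := by
    refine Multiset.Nodup.map_on ?_ (Finset.Icc 1 r).nodup
    intro i hi j hj hij
    rw [Finset.mem_val, Finset.mem_Icc] at hi hj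
    rcases lt_trichotomy i j with h | h | h
    · linarith [hanti i j hi.1 h hj.2]
    · exact h
    · linarith [hanti j i hj.1 h hi.2]
  -- The `l i` are `r` distinct roots, so they exhaust the degree.
  have hroots : G.roots = (Finset.Icc 1 r).val.map l := by
    symm
    refine Multiset.eq_of_le_of_card_le ?_ ?_
    · refine (Multiset.le_iff_subset hnodup).2 fun x hx => ?_
      obtain ⟨i, hi, rfl⟩ := Multiset.mem_map.1 hx
      rw [Finset.mem_val, Finset.mem_Icc] at hi
      exact (mem_roots hG).2 (hl3 i hi.1 hi.2)
    · refine G.card_roots'.trans ?_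
      rw [hdeg, Multiset.card_map]
      simp
  refine ⟨l, hl1, fun i h1 h2 => hl2 i h1 h2.le h2, hroots, ?_⟩
  have h := C_leadingCoeff_mul_prod_multiset_X_sub_C (p := G) (by simp [hroots, hdeg])
  rw [hroots, Multiset.map_map] at h
  exact h.symm

/-! ### The characteristic polynomials of a chain and of its principal submatrix -/

namespace IsEigenframe

variable {n : ℕ} {P : Matrix (Fin (n + 1)) (Fin (n + 1)) ℝ} {π : Fin (n + 1) → ℝ}
  {U : Matrix (Fin n) (Fin n) ℝ} {η : Fin n → ℝ} (hU : IsEigenframe P π U η)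
include hU

/-- A Perron argument. If `η_k ≥ 1`, then `g = |u_k|`, extended by `0` at state `0`, satisfies `g ≤
g P`, hence `g ≤ g P^t`. Total masses agree, so equality holds; at state `0`, positivity of `P^t`
forces `u_k = 0`. -/
lemma eigenvalue_lt_one (hP : IsReversibleErgodic P π) (k : Fin n) : η k < 1 := by
  by_contra! hη
  set u := eigRow π U k with hu
  set g : Fin (n + 1) → ℝ := Fin.cons 0 (fun m => |u m|) with hg
  have hg0 : ∀ i, 0 ≤ g i := by
    intro i
    refine Fin.cases ?_ (fun m => ?_) i
    · simp [hg]
    · simp [hg]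
  have hP0 : ∀ i j, 0 ≤ P i j := fun i j => Matrix.nonneg_of_mem_rowStochastic hP.stochastic
  have h1 : ∀ i, g i ≤ Matrix.vecMul g P i := by
    intro i
    refine Fin.cases ?_ (fun m => ?_) i
    · rw [show g 0 = 0 from rfl]
      exact Matrix.nonneg_vecMul_of_mem_rowStochastic hP.stochastic hg0 0
    · have h2 := congrFun (hU.eigRow_vecMul hP k) m
      rw [Matrix.vecMul, dotProduct, Fin.sum_univ_succ, show g 0 = 0 from rfl, zero_mul, zero_add]
      simp only [Matrix.vecMul, dotProduct, deleteZero, Matrix.submatrix_apply, Pi.smul_apply,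
        smul_eq_mul] at h2
      calc g m.succ = 1 * |u m| := by simp [hg]
        _ ≤ |η k| * |u m| := by gcongr; exact hη.trans (le_abs_self _)
        _ = |∑ l, u l * P l.succ m.succ| := by rw [← abs_mul, h2]
        _ ≤ ∑ l, |u l * P l.succ m.succ| := Finset.abs_sum_le_sum_abs _ _
        _ = ∑ l : Fin n, g l.succ * P l.succ m.succ := by
          refine Finset.sum_congr rfl fun l _ => ?_
          rw [abs_mul, abs_of_nonneg (hP0 _ _)]
          simp [hg]
  have h2 : ∀ t i, g i ≤ Matrix.vecMul g (P ^ t) i := by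
    intro t
    induction t with
    | zero => intro i; simp
    | succ t ih =>
      intro i
      refine (h1 i).trans ?_
      rw [pow_succ, ← Matrix.vecMul_vecMul]
      simp only [Matrix.vecMul, dotProduct] at ih ⊢
      exact Finset.sum_le_sum fun l _ => mul_le_mul_of_nonneg_right (ih l) (hP0 l i)
  obtain ⟨t, -, ht⟩ := hP.ergodic.exists_pos_pow
  have h3 : ∑ i, g i = ∑ i, Matrix.vecMul g (P ^ t) i := by
    rw [sum_vecMul g (Matrix.sum_row_of_mem_rowStochastic (Submonoid.pow_mem _ hP.stochastic t))]
  have h4 := (Finset.sum_eq_sum_iff_of_le fun i _ => h2 t i).1 h3 0 (Finset.mem_univ 0)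
  rw [show g 0 = 0 from rfl, eq_comm, Matrix.vecMul, dotProduct,
    Finset.sum_eq_zero_iff_of_nonneg fun l _ => mul_nonneg (hg0 l) (ht l 0).le] at h4
  have h5 : ∀ m, U k m = 0 := by
    intro m
    have h6 := (mul_eq_zero.1 (h4 m.succ (Finset.mem_univ _))).resolve_right (ht _ _).ne'
    simp only [hg, Fin.cons_succ, abs_eq_zero, hu, eigRow] at h6
    exact (mul_eq_zero.1 h6).resolve_right (Real.sqrt_pos.2 (hP.pos _)).ne'
  have h7 := congrFun (congrFun hU.orthogonal k) k
  simp [Matrix.mul_apply, h5] at h7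

/-- With `M = z - P`, the vector `x = π - (z - 1) (0 | q)` satisfies `x M = c δ₀`, where `q` is
`(π(1), …, π(n))` times the resolvent of `P₀` and `c` is the last factor of the claim. Multiplying
by the adjugate and reading coordinate `0` gives `π(0) det M = c det (z - P₀)`, also where `M` is
singular. -/
lemma eval_charpoly_mul (hP : IsReversibleErgodic P π) {z : ℝ} (hz : ∀ k, z ≠ η k) :
    π 0 * P.charpoly.eval z = (deleteZero P).charpoly.eval z *
      ((z - 1) * (1 - (z - 1) * ∑ k, eigCoord π U k ^ 2 / (z - η k))) := by
  set q : Fin n → ℝ := fun m => ∑ k, eigCoord π U k / (z - η k) * eigRow π U k m with hq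
  set x : Fin (n + 1) → ℝ := π - (z - 1) • (Fin.cons 0 q : Fin (n + 1) → ℝ) with hx
  set M := Matrix.scalar (Fin (n + 1)) z - P with hM
  have hx0 : x 0 = π 0 := by simp [hx]
  have hxs : ∀ m : Fin n, x m.succ = π m.succ - (z - 1) * q m := fun m => by simp [hx]
  have hqs : ∑ m, q m = ∑ k, eigCoord π U k ^ 2 / (z - η k) := by
    rw [hq, Finset.sum_comm]
    refine Finset.sum_congr rfl fun k _ => ?_
    rw [← Finset.mul_sum, sum_eigRow]
    ring
  have hqP : ∀ m, ∑ l, q l * P l.succ m.succ = z * q m - π m.succ := by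
    intro m
    rw [← hU.sum_eigCoord_mul_eigRow hP m]
    simp only [hq, Finset.sum_mul, Finset.mul_sum]
    rw [Finset.sum_comm, ← Finset.sum_sub_distrib]
    refine Finset.sum_congr rfl fun k _ => ?_
    have h2 := congrFun (hU.eigRow_vecMul hP k) m
    simp only [Matrix.vecMul, dotProduct, deleteZero, Matrix.submatrix_apply, Pi.smul_apply,
      smul_eq_mul] at h2
    simp_rw [mul_assoc]
    rw [← Finset.mul_sum, h2]
    have := sub_ne_zero.2 (hz k)
    field_simp
    ring
  have hMrow : ∀ i, ∑ j, M i j = z - 1 := by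
    intro i
    simp [hM, Finset.sum_sub_distrib, Matrix.sum_row_of_mem_rowStochastic hP.stochastic,
      Matrix.diagonal_apply]
  have hxM : Matrix.vecMul x M =
      Pi.single 0 ((z - 1) * (1 - (z - 1) * ∑ k, eigCoord π U k ^ 2 / (z - η k))) := by
    refine eq_of_sum_eq_of_ne_zero ?_ fun j hj => ?_
    · simp only [Matrix.vecMul, dotProduct]
      rw [Finset.sum_comm]
      simp only [← Finset.mul_sum, hMrow]
      rw [← Finset.sum_mul, Fin.sum_univ_succ, hx0, Finset.sum_congr rfl fun m _ => hxs m,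
        Finset.sum_sub_distrib, ← Finset.mul_sum, hqs, hP.sum_succ]
      simp
      ring
    · obtain ⟨m, rfl⟩ := Fin.exists_succ_eq.2 hj
      rw [Pi.single_eq_of_ne hj, hM, Matrix.vecMul_sub, Pi.sub_apply, Matrix.scalar_apply,
        Matrix.vecMul_diagonal, hxs]
      have h1 := congrFun hP.stationary m.succ
      rw [Matrix.vecMul, dotProduct, Fin.sum_univ_succ] at h1 ⊢
      rw [hx0, Finset.sum_congr rfl fun l _ => by rw [hxs l, sub_mul, mul_assoc],
        Finset.sum_sub_distrib, ← Finset.mul_sum, hqP]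
      linear_combination -h1
  have h1 := congrFun (congrArg (fun v => Matrix.vecMul v M.adjugate) hxM) 0
  simp only [Matrix.vecMul_vecMul, Matrix.mul_adjugate] at h1
  rw [Matrix.vecMul_smul, Matrix.vecMul_one, Pi.smul_apply, hx0, smul_eq_mul,
    Matrix.single_vecMul, Pi.smul_apply, smul_eq_mul, Matrix.row_apply,
    Matrix.adjugate_fin_succ_eq_det_submatrix] at h1
  have h2 : M.submatrix (Fin.succAbove 0) (Fin.succAbove 0) =
      Matrix.scalar (Fin n) z - deleteZero P := by
    ext i j
    simp [hM, deleteZero, Matrix.diagonal_apply]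
  rw [h2] at h1
  rw [Matrix.eval_charpoly, Matrix.eval_charpoly, mul_comm (π 0), h1]
  simp [mul_comm]

end IsEigenframe

/-- The polynomial `∏ (X - g i) · (p + ∑ a i (1 - g i) / (X - g i))`, both over `1 ≤ i ≤ r`. -/
def secular (r : ℕ) (p : ℝ) (g a : ℕ → ℝ) : Polynomial ℝ :=
  Polynomial.C p * ∏ i ∈ Finset.Icc 1 r, (Polynomial.X - Polynomial.C (g i)) +
    ∑ i ∈ Finset.Icc 1 r, Polynomial.C (a i * (1 - g i)) *
      ∏ j ∈ (Finset.Icc 1 r).erase i, (Polynomial.X - Polynomial.C (g j))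

/-! ### Degree, leading coefficient and values of the secular polynomial -/

section secular

open Polynomial

variable {r : ℕ} {p : ℝ} {g a : ℕ → ℝ}

lemma secular_degree_lt : (∑ i ∈ Finset.Icc 1 r, C (a i * (1 - g i)) *
    ∏ j ∈ (Finset.Icc 1 r).erase i, (X - C (g j))).degree < (r : WithBot ℕ) := by
  refine (degree_sum_le _ _).trans_lt ((Finset.sup_lt_iff (WithBot.bot_lt_coe r)).2 fun i hi => ?_)
  rw [degree_mul, degree_prod]
  refine lt_of_le_of_lt (add_le_add degree_C_le le_rfl) ?_
  rw [zero_add]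
  simp only [degree_X_sub_C, Finset.sum_const, Finset.card_erase_of_mem hi]
  have := Finset.mem_Icc.1 hi
  simp only [Nat.card_Icc, Nat.add_sub_cancel, nsmul_eq_mul, mul_one]
  exact WithBot.coe_lt_coe.2 (Nat.cast_lt.2 (by omega : r - 1 < r))

lemma degree_C_mul_prod (hp : p ≠ 0) :
    (C p * ∏ i ∈ Finset.Icc 1 r, (X - C (g i))).degree = (r : WithBot ℕ) := by
  rw [degree_C_mul hp, degree_prod]
  simp

lemma natDegree_secular (hp : p ≠ 0) : (secular r p g a).natDegree = r := by
  refine natDegree_eq_of_degree_eq_some ?_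
  rw [secular, degree_add_eq_left_of_degree_lt, degree_C_mul_prod hp]
  rw [degree_C_mul_prod hp]
  exact secular_degree_lt

lemma leadingCoeff_secular (hp : p ≠ 0) : (secular r p g a).leadingCoeff = p := by
  rw [secular, leadingCoeff_add_of_degree_lt', leadingCoeff_mul, leadingCoeff_C,
    (monic_prod_X_sub_C _ _).leadingCoeff, mul_one]
  rw [degree_C_mul_prod hp]
  exact secular_degree_lt

lemma eval_secular_of_ne {z : ℝ} (hz : ∀ i ∈ Finset.Icc 1 r, z ≠ g i) :
    (secular r p g a).eval z = (∏ i ∈ Finset.Icc 1 r, (z - g i)) *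
      (p + ∑ i ∈ Finset.Icc 1 r, a i * (1 - g i) / (z - g i)) := by
  simp only [secular, eval_add, eval_mul, eval_C, eval_prod, eval_sub, eval_X, eval_finsetSum]
  rw [mul_add, mul_comm p, Finset.mul_sum]
  congr 1
  refine Finset.sum_congr rfl fun i hi => ?_
  rw [← Finset.mul_prod_erase _ _ hi]
  have := sub_ne_zero.2 (hz i hi)
  field_simp

lemma eval_secular_node {i : ℕ} (hi : i ∈ Finset.Icc 1 r) :
    (secular r p g a).eval (g i) =
      (1 - g i) * a i * ∏ j ∈ (Finset.Icc 1 r).erase i, (g i - g j) := by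
  simp only [secular, eval_add, eval_mul, eval_C, eval_prod, eval_sub, eval_X, eval_finsetSum]
  rw [Finset.prod_eq_zero hi (sub_self _), mul_zero, zero_add, Finset.sum_eq_single i]
  · ring
  · intro j _ hji
    rw [Finset.prod_eq_zero (Finset.mem_erase.2 ⟨hji.symm, hi⟩) (sub_self _), mul_zero]
  · exact fun h => absurd hi h

lemma eval_secular_one (hg : ∀ i ∈ Finset.Icc 1 r, g i < 1)
    (ha : p + ∑ i ∈ Finset.Icc 1 r, a i = 1) :
    (secular r p g a).eval 1 = ∏ i ∈ Finset.Icc 1 r, (1 - g i) := by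
  rw [eval_secular_of_ne fun i hi => (hg i hi).ne']
  have : ∀ i ∈ Finset.Icc 1 r, a i * (1 - g i) / (1 - g i) = a i := fun i hi =>
    mul_div_cancel_right₀ _ (by linarith [hg i hi])
  rw [Finset.sum_congr rfl this, ha, mul_one]

end secular

lemma sum_Icc_sum_filter_eq {n r : ℕ} {η : Fin n → ℝ} {g : ℕ → ℝ} (f : Fin n → ℝ)
    (hinj : ∀ i ∈ Finset.Icc 1 r, ∀ j ∈ Finset.Icc 1 r, g i = g j → i = j)
    (hf : ∀ k, (∀ i ∈ Finset.Icc 1 r, η k ≠ g i) → f k = 0) :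
    ∑ i ∈ Finset.Icc 1 r, ∑ k with η k = g i, f k = ∑ k, f k := by
  simp_rw [Finset.sum_filter]
  rw [Finset.sum_comm]
  refine Finset.sum_congr rfl fun k _ => ?_
  by_cases hk : ∃ i ∈ Finset.Icc 1 r, η k = g i
  · obtain ⟨i, hi, hik⟩ := hk
    rw [Finset.sum_eq_single_of_mem i hi, if_pos hik]
    exact fun j hj hji => if_neg fun hjk => hji (hinj j hj i hi (hjk.symm.trans hik))
  · push Not at hk
    rw [hf k hk]
    simp

open Polynomial in
-- `eval_charpoly_mul` with denominators cleared: the two polynomials agree off the finite set of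
-- the `η_k` and `g_i`.
lemma IsEigenframe.charpoly_mul_prod {n r : ℕ} {P : Matrix (Fin (n + 1)) (Fin (n + 1)) ℝ}
    {π : Fin (n + 1) → ℝ} {U : Matrix (Fin n) (Fin n) ℝ} {η : Fin n → ℝ} {g : ℕ → ℝ}
    (hU : IsEigenframe P π U η) (hP : IsReversibleErgodic P π)
    (hinj : ∀ i ∈ Finset.Icc 1 r, ∀ j ∈ Finset.Icc 1 r, g i = g j → i = j)
    (hzero : ∀ k, (∀ i ∈ Finset.Icc 1 r, η k ≠ g i) → eigCoord π U k = 0) :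
    C (π 0) * (P.charpoly * ∏ i ∈ Finset.Icc 1 r, (X - C (g i))) =
      (deleteZero P).charpoly * ((X - C 1) *
        secular r (π 0) g (fun i => ∑ k with η k = g i, eigCoord π U k ^ 2)) := by
  classical
  refine eq_of_infinite_eval_eq _ _ ?_
  refine Set.Infinite.mono ?_ ((Finset.univ.image η ∪ (Finset.Icc 1 r).image g).finite_toSet
    |>.infinite_compl)
  intro z hz
  simp only [Finset.coe_union, Finset.coe_image, Finset.coe_univ, Set.image_univ, Set.mem_compl_iff,
    Set.mem_union, Set.mem_range, Set.mem_image, Finset.mem_coe, not_or, not_exists, not_and] at hz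
  have hz1 : ∀ k, z ≠ η k := fun k h => hz.1 k h.symm
  have hz2 : ∀ i ∈ Finset.Icc 1 r, z ≠ g i := fun i hi h => hz.2 i hi h.symm
  have h1 := hU.eval_charpoly_mul hP hz1
  -- Uses `∑ a_k² = 1 - π(0)` and `1 - (z - 1) / (z - η) = (1 - η) / (z - η)`.
  have h2 : 1 - (z - 1) * ∑ k, eigCoord π U k ^ 2 / (z - η k) =
      π 0 + ∑ i ∈ Finset.Icc 1 r,
        (∑ k with η k = g i, eigCoord π U k ^ 2) * (1 - g i) / (z - g i) := by
    have h3 : ∑ i ∈ Finset.Icc 1 r,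
        (∑ k with η k = g i, eigCoord π U k ^ 2) * (1 - g i) / (z - g i) =
        ∑ k, eigCoord π U k ^ 2 * (1 - η k) / (z - η k) := by
      rw [← sum_Icc_sum_filter_eq (r := r) (η := η) (g := g) _ hinj]
      · refine Finset.sum_congr rfl fun i _ => ?_
        rw [Finset.sum_mul, Finset.sum_div]
        exact Finset.sum_congr rfl fun k hk => by rw [(Finset.mem_filter.1 hk).2]
      · intro k hk
        rw [hzero k hk]
        simp
    have h4 : π 0 = 1 - ∑ k, eigCoord π U k ^ 2 := by rw [hU.sum_eigCoord_sq hP]; ring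
    rw [h3, h4, sub_add, ← Finset.sum_sub_distrib, Finset.mul_sum]
    congr 1
    refine Finset.sum_congr rfl fun k _ => ?_
    have := sub_ne_zero.2 (hz1 k)
    field_simp
    ring
  rw [Set.mem_ofPred_eq]
  simp only [eval_mul, eval_C, eval_sub, eval_X]
  rw [eval_secular_of_ne hz2, ← h2, ← mul_assoc, h1, eval_prod]
  simp only [eval_sub, eval_X, eval_C]
  ring

/-! ### The reduced spectra -/

/-- For each element `a` or `b` has multiplicity zero, so the other is the excess of one of `s`, `t`
over their common part. This turns the identity of root multisets into the cancellation that defines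
the reduced spectra. -/
lemma sub_inter_of_add_eq_add {α : Type*} [DecidableEq α] {s t a b : Multiset α}
    (h : s + a = t + b) (hd : ∀ x ∈ a, x ∉ b) : t - s ∩ t = a ∧ s - s ∩ t = b := by
  have key : ∀ x, s.count x + a.count x = t.count x + b.count x ∧
      (a.count x = 0 ∨ b.count x = 0) := by
    intro x
    refine ⟨by rw [← Multiset.count_add, h, Multiset.count_add], ?_⟩
    by_cases hx : x ∈ a
    · exact Or.inr (Multiset.count_eq_zero.2 (hd x hx))
    · exact Or.inl (Multiset.count_eq_zero.2 hx)
  constructor <;>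
  · ext x
    rw [Multiset.count_sub, Multiset.count_inter]
    have := key x
    omega

lemma sort_eq_of_strictAnti {m : ℕ} {f : ℕ → ℝ} (hf : ∀ i j, i < j → j < m → f j < f i) :
    ((Multiset.range m).map f).sort (· ≥ ·) = (List.range m).map f := by
  refine List.Perm.eq_of_pairwise' (r := (· ≥ ·)) (Multiset.pairwise_sort _ _) ?_ ?_
  · rw [List.pairwise_map]
    refine List.Pairwise.imp_of_mem ?_ (List.pairwise_lt_range (n := m))
    intro i j _ hj hij
    exact (hf i j hij (List.mem_range.1 hj)).le
  · rw [← Multiset.coe_eq_coe, Multiset.sort_eq]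
    rfl

lemma map_sort_getD (s : Multiset ℝ) :
    (Multiset.range s.card).map (fun i => (s.sort (· ≥ ·)).getD i 0) = s := by
  conv_rhs => rw [← Multiset.sort_eq s (· ≥ ·)]
  refine congrArg _ (List.ext_getElem (by simp) fun i h1 h2 => ?_)
  simp [List.getElem?_eq_getElem h2]

lemma map_Icc_one {α : Type*} (r : ℕ) (f : ℕ → α) :
    (Finset.Icc 1 r).val.map f = (Multiset.range r).map (fun i => f (i + 1)) := by
  have : Finset.Icc 1 r = (Finset.range r).map ⟨(· + 1), add_left_injective 1⟩ := by
    ext x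
    simp only [Finset.mem_Icc, Finset.mem_map, Finset.mem_range, Function.Embedding.coeFn_mk]
    exact ⟨fun h => ⟨x - 1, by omega, by omega⟩, by rintro ⟨y, hy, rfl⟩; omega⟩
  rw [this, Finset.map_val, Multiset.map_map]
  rfl

lemma getD_sort_strictAnti {s : Multiset ℝ} (hs : s.Nodup) (i j : ℕ) (hij : i < j)
    (hj : j < s.card) : (s.sort (· ≥ ·)).getD j 0 < (s.sort (· ≥ ·)).getD i 0 := by
  have hl : (s.sort (· ≥ ·)).length = s.card := Multiset.length_sort _
  have h1 := List.pairwise_iff_getElem.1 (Multiset.pairwise_sort s (· ≥ ·)) i j (by omega)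
    (by omega) hij
  have h2 : (s.sort (· ≥ ·)).Nodup := by rwa [← Multiset.coe_nodup, Multiset.sort_eq]
  rw [List.getD_eq_getElem _ _ (by omega), List.getD_eq_getElem _ _ (by omega)]
  refine lt_of_le_of_ne h1 fun h => hij.ne' ?_
  exact (h2.getElem_inj_iff).1 h

open Polynomial in
/-- The reduced spectra interlace strictly, and they determine the squared length of the
projection of the stationary distribution on each eigenspace of the principal submatrix. -/
lemma IsEigenframe.reducedSpec_interlaced {n : ℕ} {P : Matrix (Fin (n + 1)) (Fin (n + 1)) ℝ}
    {π : Fin (n + 1) → ℝ} {U : Matrix (Fin n) (Fin n) ℝ} {η : Fin n → ℝ}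
    (hU : IsEigenframe P π U η) (hP : IsReversibleErgodic P π) {r : ℕ} (hr : r = reducedCard P) :
    (reducedSpec P).card = r + 1 ∧
    StrictlyInterlaced r (reducedLam P) (reducedGam P) ∧
    (∏ j ∈ Finset.Icc 1 r, (1 - reducedGam P j) =
      π 0 * ∏ j ∈ Finset.Icc 1 r, (1 - reducedLam P j)) ∧
    (∀ i ∈ Finset.Icc 1 r, (1 - reducedGam P i) *
        (∑ k with η k = reducedGam P i, eigCoord π U k ^ 2) *
        ∏ j ∈ (Finset.Icc 1 r).erase i, (reducedGam P i - reducedGam P j) =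
      π 0 * ∏ j ∈ Finset.Icc 1 r, (reducedGam P i - reducedLam P j)) ∧
    ∀ k, (∀ i ∈ Finset.Icc 1 r, η k ≠ reducedGam P i) → eigCoord π U k = 0 := by
  classical
  -- The eigenvalues of `P₀` on whose eigenspace `π` has a nonzero component; they turn out to be
  -- the reduced spectrum of `P₀`.
  set Γ : Finset ℝ := Finset.univ.image η |>.filter
    fun x => ∑ k with η k = x, eigCoord π U k ^ 2 ≠ 0 with hΓ
  set c := Γ.card with hc
  set g : ℕ → ℝ := fun i => (Γ.val.sort (· ≥ ·)).getD (i - 1) 0 with hgdef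
  set a : ℕ → ℝ := fun i => ∑ k with η k = g i, eigCoord π U k ^ 2 with ha
  have hmap : (Finset.Icc 1 c).val.map g = Γ.val := by
    rw [map_Icc_one]
    exact map_sort_getD Γ.val
  have hanti : ∀ i j, 1 ≤ i → i < j → j ≤ c → g j < g i := fun i j h1 h2 h3 =>
    getD_sort_strictAnti Γ.nodup (i - 1) (j - 1) (by omega)
      (by change j - 1 < c; omega)
  have hmem : ∀ x, x ∈ Γ ↔ ∃ i ∈ Finset.Icc 1 c, g i = x := by
    intro x
    rw [← Finset.mem_val, ← hmap, Multiset.mem_map]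
    rfl
  have hinj : ∀ i ∈ Finset.Icc 1 c, ∀ j ∈ Finset.Icc 1 c, g i = g j → i = j := by
    intro i hi j hj hij
    rw [Finset.mem_Icc] at hi hj
    rcases lt_trichotomy i j with h | h | h
    · linarith [hanti i j hi.1 h hj.2]
    · exact h
    · linarith [hanti j i hj.1 h hi.2]
  have hapos : ∀ i ∈ Finset.Icc 1 c, 0 < a i := by
    intro i hi
    have := (Finset.mem_filter.1 ((hmem _).2 ⟨i, hi, rfl⟩)).2
    exact (Finset.sum_nonneg fun k _ => sq_nonneg _).lt_of_ne' this
  have hlt : ∀ i ∈ Finset.Icc 1 c, g i < 1 := by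
    intro i hi
    obtain ⟨k, -, hk⟩ := Finset.mem_image.1 (Finset.mem_filter.1 ((hmem _).2 ⟨i, hi, rfl⟩)).1
    exact hk ▸ hU.eigenvalue_lt_one hP k
  have hzero : ∀ k, (∀ i ∈ Finset.Icc 1 c, η k ≠ g i) → eigCoord π U k = 0 := by
    intro k hk
    have h1 : η k ∉ Γ := fun h => by
      obtain ⟨i, hi, hik⟩ := (hmem _).1 h
      exact hk i hi hik.symm
    simp only [hΓ, Finset.mem_filter, Finset.mem_image, Finset.mem_univ, true_and,
      exists_apply_eq_apply, not_not] at h1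
    rw [Finset.sum_eq_zero_iff_of_nonneg fun _ _ => sq_nonneg _] at h1
    exact pow_eq_zero_iff two_ne_zero |>.1 (h1 k (by simp))
  have hp := hP.pos 0
  set G := secular c (π 0) g a with hG
  have hGd : G.natDegree = c := natDegree_secular hp.ne'
  have hGl : G.leadingCoeff = π 0 := leadingCoeff_secular hp.ne'
  have hGnode : ∀ i ∈ Finset.Icc 1 c, G.eval (g i) =
      (1 - g i) * a i * ∏ j ∈ (Finset.Icc 1 c).erase i, (g i - g j) :=
    fun i hi => eval_secular_node hi
  have hsign : ∀ i ∈ Finset.Icc 1 c,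
      0 < G.eval (g i) * ∏ j ∈ (Finset.Icc 1 c).erase i, (g i - g j) := by
    intro i hi
    have h1 := sign_prod_sub_pos hanti hi
    rw [hGnode i hi, mul_assoc, ← sq]
    refine mul_pos (mul_pos (by linarith [hlt i hi]) (hapos i hi)) (sq_pos_of_ne_zero fun h => ?_)
    rw [h, mul_zero] at h1
    exact h1.false
  obtain ⟨l, hl1, hl2, hroots, hfac⟩ := exists_interlacing_roots hanti hGd (hGl ▸ hp) hsign
  have hsum : π 0 + ∑ i ∈ Finset.Icc 1 c, a i = 1 := by
    rw [ha, sum_Icc_sum_filter_eq _ hinj fun k hk => by rw [hzero k hk]; simp,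
      hU.sum_eigCoord_sq hP]
    ring
  have hfac' : ∀ z, G.eval z = π 0 * ∏ j ∈ Finset.Icc 1 c, (z - l j) := by
    intro z
    rw [hfac, hGl]
    simp [eval_prod]
  have hG0 : G ≠ 0 := fun h => by simp [h] at hGl; exact hp.ne hGl
  have hcp : (P.charpoly * ∏ i ∈ Finset.Icc 1 c, (X - C (g i))) ≠ 0 :=
    mul_ne_zero P.charpoly_monic.ne_zero (monic_prod_X_sub_C _ _).ne_zero
  have hspec : spec P + Γ.val = spec (deleteZero P) + (1 ::ₘ (Finset.Icc 1 c).val.map l) := by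
    have h1 := congrArg roots (hU.charpoly_mul_prod hP hinj hzero)
    have hX : (X - C (1 : ℝ)) * G ≠ 0 := mul_ne_zero (X_sub_C_ne_zero 1) hG0
    rw [roots_C_mul _ hp.ne', roots_mul hcp, roots_mul (mul_ne_zero
      (deleteZero P).charpoly_monic.ne_zero hX), roots_mul hX, hroots, roots_X_sub_C] at h1
    have h2 : (∏ i ∈ Finset.Icc 1 c, (X - C (g i))).roots = Γ.val := by
      rw [← hmap]
      have := roots_multiset_prod_X_sub_C ((Finset.Icc 1 c).val.map g)
      rwa [Multiset.map_map] at this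
    rw [h2] at h1
    exact h1
  -- No further cancellation: every `g_i` is below `1`, and `G` does not vanish at `g_i`.
  have hdisj : ∀ x ∈ Γ.val, x ∉ (1 ::ₘ (Finset.Icc 1 c).val.map l) := by
    intro x hx hx'
    obtain ⟨i, hi, rfl⟩ := (hmem x).1 hx
    rcases Multiset.mem_cons.1 hx' with h | h
    · exact (hlt i hi).ne h
    · rw [← hroots, mem_roots hG0, IsRoot.def] at h
      have := hsign i hi
      rw [h, zero_mul] at this
      exact this.false
  obtain ⟨hz1, hz2⟩ := sub_inter_of_add_eq_add hspec hdisj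
  have hz1' : reducedSpecZero P = Γ.val := hz1
  have hz2' : reducedSpec P = (Multiset.range (c + 1)).map (fun i => if i = 0 then 1 else l i) := by
    rw [reducedSpec, hz2, map_Icc_one]
    have : Multiset.range (c + 1) = 0 ::ₘ (Multiset.range c).map (· + 1) := by
      change ((List.range (c + 1) : List ℕ) : Multiset ℕ) = _
      rw [List.range_succ_eq_map]
      rfl
    rw [this, Multiset.map_cons, Multiset.map_map]
    simp
  have hrc : r = c := by rw [hr, reducedCard, hz1']; rfl
  have hgam : reducedGam P = g := by
    funext i
    rw [reducedGam, hz1']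
  have hlanti : ∀ i j, i < j → j < c + 1 →
      (if j = 0 then 1 else l j) < (if i = 0 then 1 else l i) := by
    intro i j hij hj
    rw [if_neg (by omega)]
    have h1 := hl1 j (by omega) (by omega)
    split_ifs with hi
    · exact h1.trans (hlt j (Finset.mem_Icc.2 ⟨by omega, by omega⟩))
    · have h2 := hl2 i (by omega) (by omega)
      rcases Nat.lt_or_ge (i + 1) j with h | h
      · linarith [hanti (i + 1) j (by omega) h (by omega)]
      · rw [show j = i + 1 by omega] at h1 ⊢
        linarith
  have hlam : ∀ i ≤ c, reducedLam P i = if i = 0 then 1 else l i := by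
    intro i hi
    rw [reducedLam, hz2', sort_eq_of_strictAnti hlanti, List.getD_eq_getElem _ _ (by simp; omega)]
    simp
  have hlam' : ∀ i ∈ Finset.Icc 1 c, reducedLam P i = l i := by
    intro i hi
    rw [Finset.mem_Icc] at hi
    rw [hlam i hi.2, if_neg (by omega)]
  subst hrc
  rw [hgam]
  refine ⟨by simp [hz2'], ⟨by simp [hlam], fun i h1 h2 => ?_, fun i h1 h2 => ?_⟩, ?_, ?_, hzero⟩
  · rw [hlam' i (Finset.mem_Icc.2 ⟨h1, h2⟩)]
    exact hl1 i h1 h2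
  · rw [hlam (i - 1) (by omega)]
    split_ifs with hi
    · exact hlt i (Finset.mem_Icc.2 ⟨h1, h2⟩)
    · have := hl2 (i - 1) (by omega) (by omega)
      rwa [show i - 1 + 1 = i by omega] at this
  · rw [← eval_secular_one hlt hsum, ← hG, hfac' 1]
    congr 1
    exact Finset.prod_congr rfl fun j hj => by rw [hlam' j hj]
  · intro i hi
    rw [← hGnode i hi, hfac' (g i)]
    congr 1
    exact Finset.prod_congr rfl fun j hj => by rw [hlam' j hj]

end InterlacedHitting

end

/-! ### Assembly of the theorem -/

open InterlacedHitting in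
theorem theorem3p9 {n : ℕ} (P : Matrix (Fin (n + 1)) (Fin (n + 1)) ℝ)
    (π : Fin (n + 1) → ℝ) (hP : IsReversibleErgodic P π)
    (r : ℕ) (hr : r = reducedCard P)
    (lam gam ρ : ℕ → ℝ) (hlam : lam = reducedLam P) (hgam : gam = reducedGam P)
    (hρ : ∀ i, ρ i = (1 - gam i) / (1 - lam i))
    (hnonneg : 0 ≤ lam r) :
    -- the reduced spectra have `r + 1` and `r` elements and strictly interlace
    ((reducedSpec P).card = r + 1 ∧ lam 0 = 1 ∧
      ∀ i, 1 ≤ i → i ≤ r → lam i < gam i ∧ gam i < lam (i - 1)) ∧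
    -- `(π̂, P̂)` is a Markov chain
    (hatDist r ρ r ∈ stdSimplex ℝ (Fin (r + 1)) ∧
      hatMatrix r ρ gam ∈ Matrix.rowStochastic ℝ (Fin (r + 1))) ∧
    -- `Λ₂` is a link between `(π*, P*_abs)` and `(π̂, P̂)`
    ((∀ i j, 0 ≤ linkTwo r ρ gam i j) ∧
      IsQuasiIntertwining (linkTwo r ρ gam) (starDist r ρ gam r) (absorb (starMatrix r ρ gam))
        (hatDist r ρ r) (hatMatrix r ρ gam) ∧
      MatchesZero (linkTwo r ρ gam)) ∧
    -- eigenframes exist, and for each of them `Λ₁` and `Λ = Λ₂ Λ₁` are quasi-links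
    (∃ U η, IsEigenframe P π U η) ∧
    (∀ U η, IsEigenframe P π U η →
      (IsQuasiIntertwining (linkOne r ρ gam π U η) π (absorb P)
          (starDist r ρ gam r) (absorb (starMatrix r ρ gam)) ∧
        MatchesZero (linkOne r ρ gam π U η)) ∧
      (IsQuasiIntertwining (linkTwo r ρ gam * linkOne r ρ gam π U η) π (absorb P)
          (hatDist r ρ r) (hatMatrix r ρ gam) ∧
        MatchesZero (linkTwo r ρ gam * linkOne r ρ gam π U η))) ∧
    -- equality of the hitting-time laws of the given chain and the downward chain
    (∀ (Ω : Type*) (_ : MeasurableSpace Ω) (μ : Measure Ω) (X : ℕ → Ω → Fin (n + 1))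
        (Ω' : Type*) (_ : MeasurableSpace Ω') (μ' : Measure Ω') (X' : ℕ → Ω' → Fin (r + 1)),
      IsMarkovChain μ X π P → IsMarkovChain μ' X' (hatDist r ρ r) (hatMatrix r ρ gam) →
      IdentDistrib (hitZero X) (hitZero X') μ μ') ∧
    -- the hitting time is distributed as a sum of independent modified geometric variables
    (∀ (Ω : Type*) (_ : MeasurableSpace Ω) (μ : Measure Ω) (X : ℕ → Ω → Fin (n + 1))
        (Ω' : Type*) (_ : MeasurableSpace Ω') (μ' : Measure Ω') (Y : Fin r → Ω' → ℕ),
      IsMarkovChain μ X π P → IsProbabilityMeasure μ' → iIndepFun Y μ' →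
      (∀ i : Fin r, HasLaw (Y i) (modifiedGeo (ρ ((i : ℕ) + 1)) (1 - gam ((i : ℕ) + 1))) μ') →
      IdentDistrib (hitZero X) (fun ω => ((∑ i, Y i ω : ℕ) : ℕ∞)) μ μ')
    := by
  -- The interlacing does not mention a frame, so any one serves to prove it; the weight identities
  -- are taken afresh for each `U` below.
  obtain ⟨U₀, η₀, hU₀⟩ := exists_isEigenframe hP
  obtain ⟨hcard, hint, -⟩ := hU₀.reducedSpec_interlaced hP hr
  subst hlam hgam
  have hgam := hint.gam_lt_gam
  have hlt := hint.gam_lt_one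
  have hρ1 := hint.rho_lt_one hρ
  have hρ0 := hint.rho_pos hρ
  have hγ0 := hint.gam_pos hnonneg
  have hdist : hatDist r ρ r ∈ stdSimplex ℝ (Fin (r + 1)) :=
    ⟨hatDist_nonneg (fun i h1 h2 => (hρ0 i h1 h2).le) (fun i h1 h2 => (hρ1 i h1 h2).le) le_rfl,
      sum_hatDist ρ le_rfl⟩
  have hstoch : hatMatrix r ρ (reducedGam P) ∈ Matrix.rowStochastic ℝ (Fin (r + 1)) :=
    hatMatrix_mem_rowStochastic (fun i h1 h2 => (hρ0 i h1 h2).le)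
      (fun i h1 h2 => (hρ1 i h1 h2).le) (fun i h1 h2 => (hγ0 i h1 h2).le)
      fun i h1 h2 => (hlt i h1 h2).le
  have hlink2 := isQuasiIntertwining_linkTwo hgam hlt fun i h1 h2 => (hρ1 i h1 h2).ne
  have hzero2 := matchesZero_linkTwo r ρ (reducedGam P)
  have hlink1 : ∀ U η, IsEigenframe P π U η →
      IsQuasiIntertwining (linkOne r ρ (reducedGam P) π U η) π (absorb P)
        (starDist r ρ (reducedGam P) r) (absorb (starMatrix r ρ (reducedGam P))) ∧
      MatchesZero (linkOne r ρ (reducedGam P) π U η) := by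
    intro U η hU
    obtain ⟨-, -, h1, h2, h3⟩ := hU.reducedSpec_interlaced hP hr
    have hpos : ∀ i : Fin (r + 1), i ≠ 0 → 1 ≤ (i : ℕ) := fun i hi =>
      Nat.one_le_iff_ne_zero.2 fun h => hi (Fin.ext h)
    have hle : ∀ i : Fin (r + 1), (i : ℕ) ≤ r := fun i => Nat.le_of_lt_succ i.2
    have hstar : ∀ i : Fin (r + 1), i ≠ 0 → starDist r ρ (reducedGam P) r i ≠ 0 := fun i hi =>
      (hint.starDist_pos hρ le_rfl (hpos i hi) (hle i)).ne'
    refine ⟨isQuasiIntertwining_linkOne hP hU hstar (sum_starDist hgam hlt le_rfl) ?_ ?_,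
      matchesZero_linkOne hstar fun i hi => hint.starDist_eq hρ (hpos i hi) h1
        (h2 i (Finset.mem_Icc.2 ⟨hpos i hi, hle i⟩))⟩
    · intro i j hi hj hij
      rcases lt_trichotomy (i : ℕ) j with h | h | h
      · linarith [hgam i j (hpos i hi) h (hle j)]
      · exact Fin.ext h
      · linarith [hgam j i (hpos j hj) h (hle i)]
    · intro k hk
      refine h3 k fun i hi => ?_
      rw [Finset.mem_Icc] at hi
      exact hk ⟨i, by omega⟩ fun h => by simp [Fin.ext_iff] at h; omega
  have hlink : ∀ U η, IsEigenframe P π U η →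
      IsQuasiIntertwining (linkTwo r ρ (reducedGam P) * linkOne r ρ (reducedGam P) π U η) π
        (absorb P) (hatDist r ρ r) (hatMatrix r ρ (reducedGam P)) ∧
      MatchesZero (linkTwo r ρ (reducedGam P) * linkOne r ρ (reducedGam P) π U η) :=
    fun U η hU => ⟨hlink2.comp (hlink1 U η hU).1, hzero2.comp (hlink1 U η hU).2⟩
  have hcdf : ∀ t, Matrix.vecMul π (absorb P ^ t) 0 =
      Matrix.vecMul (hatDist r ρ r) (hatMatrix r ρ (reducedGam P) ^ t) 0 :=
    (hlink U₀ η₀ hU₀).1.vecMul_pow_zero (hlink U₀ η₀ hU₀).2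
  refine ⟨⟨hcard, hint.lam_zero, fun i h1 h2 => ⟨hint.lam_lt i h1 h2, hint.lt_lam i h1 h2⟩⟩,
    ⟨hdist, hstoch⟩, ⟨hint.linkTwo_nonneg hρ, hlink2, hzero2⟩, ⟨U₀, η₀, hU₀⟩,
    fun U η hU => ⟨hlink1 U η hU, hlink U η hU⟩, ?_, ?_⟩
  · intro Ω _ μ X Ω' _ μ' X' hX hX'
    have := hX.isProbabilityMeasure
    have := hX'.isProbabilityMeasure
    refine identDistrib_of_measure_le_eq hX.measurable_hitZero.aemeasurable
      hX'.measurable_hitZero.aemeasurable fun t => ?_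
    rw [hX.measure_hitZero_le hP.stochastic hP.distribution, hX'.measure_hitZero_le hstoch hdist,
      absorb_hatMatrix, hcdf]
  · intro Ω _ μ X Ω' _ μ' Y hX _ hY hlaw
    have := hX.isProbabilityMeasure
    have hYm : AEMeasurable (fun ω => ∑ i, Y i ω) μ' :=
      Finset.univ.aemeasurable_fun_sum fun i _ => (hlaw i).aemeasurable
    refine identDistrib_of_measure_le_eq hX.measurable_hitZero.aemeasurable
      (Measurable.of_discrete.comp_aemeasurable hYm) fun t => ?_
    rw [hX.measure_hitZero_le hP.stochastic hP.distribution, hcdf,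
      ← measure_sum_modifiedGeo_le (fun i h1 h2 => (hρ0 i h1 h2).le)
        (fun i h1 h2 => (hρ1 i h1 h2).le) (fun i h1 h2 => (hγ0 i h1 h2).le) hlt hY hlaw le_rfl t]
    congr 1
    ext ω
    simp [-Nat.cast_sum]
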